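/- Let $K$ be a field of characteristic $0$, $\theta=t\frac{d}{dt}$, and write $g'=\theta g$. Let $n\ge 1$ and let $\mathcal L=\theta^n+\sum_{i=0}^{n-1}a_i\theta^i$ with $a_i\in K(t)$ be a Calabi-Yau operator, i.e. - (N) $a_i\in K(t)\cap K[[t]]$ for all $i$ and $s^n+\sum_i a_i(0)s^i=s^n$; - (self-adjointness) $\mathcal L^*=(-1)^n\beta\,\mathcal L\,\beta^{-1}$, where $\mathcal L^*=(-1)^n\theta^n+\sum_i(-1)^i\theta^i a_i$ and $\beta=\exp\left(\frac2n\int a_{n-1}\frac{dt}{t}\right)\in 1+tK[[t]]$. Let $\Lambda_{\mathcal L}=K[[t]][\theta]/K[[t]][\theta]\mathcal L$, let $\eta$ be the class of $1$, $\eta^{(j)}=\theta^j\eta$, and for $i\in\mathbb Z$ let $\operatorname{Fil}^i\subset\Lambda_{\mathcal L}$ be the $K[[t]]$-span of the $\eta^{(j)}$ with $0\le j\le n-1-i$. 1. There is a unique increasing filtration $(U_i)_{i\in\mathbb Z}$ of $\Lambda_{\mathcal L}$ by $K[[t]][\theta]$-submodules such that, for all $i$, $\Lambda_{\mathcal L}=U_i\oplus\operatorname{Fil}^{i+1}$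 and $U_{i+1}/U_i$ is a trivial $K[[t]][\theta]$-module (isomorphic to some $K[[t]]^m$, $m\ge0$, with $\theta$ acting componentwise by $t\frac{d}{dt}$). 2. There are $F_0,\dots,F_{n-1}\in K[[t]][\log t]$ with $F_0\in 1+tK[[t]]$, $\mathcal L F_i=0$ and $\sum_{r=0}^i(-1)^rF_{i-r}\frac{\log^r t}{r!}\in K[[t]]$ for $0\le i\le n-1$; if $n\ge2$ they can be chosen with $F_1/F_0-\log t\in tK[[t]]$. Let $(F_i)$ be any such family as in 2 (without the last normalization), and let $wr_{-1}=1$ and $wr_i=\det\left(F_r^{(s)}\right)_{0\le r,s\le i}$ for $0\le i\le n-1$. 3. The $wr_i$ are units of $K[[t]]$. There is a sequence $u_0,\dots,u_{n-1}\in\Lambda_{\mathcal L}$ such that for all $i$: (i) $U_i$ is generated as a $K[[t]]$-module by $u_0,\dots,u_i$; (ii) $u_i=\sum_{r=0}^{n-1-i}v_{i,r}\eta^{(r)}$ with $v_{i,r}\in K[[t]]$ and $v_{i,n-1-i}=\beta\,\frac{wr_i}{wr_{i-1}}$. It is a $K[[t]]$-basis of $\Lambda_{\mathcal L}$ and is unique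 up to constants: if $w_0,\dots,w_{n-1}$ satisfies (i) and (ii) with leading coefficients $c_i\,\beta\,\frac{wr_i}{wr_{i-1}}$ instead, for some constants $c_i\in K$, then $w_i=c_iu_i$ for all $i$ (in particular the sequence satisfying (i) and (ii) itself is unique). 4. For $0\le i\le n-2$ we have $u_{i+1}'=\tau_{i+1}u_i$ with $\tau_{i+1}=\frac{wr_{i-1}\,wr_{i+1}}{wr_i^2}$. In particular, if $n\ge2$ and $F_1/F_0=\log t+g$ with $g\in tK[[t]]$, then $q=\exp(F_1/F_0)=t\exp(g)\in t+t^2K[[t]]$ satisfies $\tau_1=(\log q)'=\theta(q)/q$. -/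

import Mathlib

open scoped PowerSeries Polynomial LaurentSeries

noncomputable section

namespace CalabiYauODE

variable {K : Type*} [Field K]

/-! ### The differential field of coefficients -/

/-- A rational function is regular at `t = 0` if it lies in `K(t) ∩ K[[t]]`, the intersection being
taken inside `K((t))`. -/
def IsRegularAtZero (f : RatFunc K) : Prop :=
  ∃ A : K⟦X⟧, (A : K⸨X⸩) = (f : K⸨X⸩)

/-- The power series expansion at `t = 0` of a rational function (meaningful if `f` is regular
at `0`, see `coe_expansion`). -/
def expansion (f : RatFunc K) : K⟦X⟧ :=
  (f.num : K⟦X⟧) * (f.denom : K⟦X⟧)⁻¹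

/-- The derivation `θ = t d/dt` of `K[[t]]`. Throughout, the derivative `g'` of the theory is
`θ g`. -/
def theta (K : Type*) [Field K] : Derivation K K⟦X⟧ K⟦X⟧ :=
  (PowerSeries.X : K⟦X⟧) • PowerSeries.derivative K

/-! ### The ring `K[[t]][θ]` of differential operators -/

/-- The `K`-algebra `K[[t]][θ]`, as the algebra of operators on `K[[t]]` generated by `θ` and by
the multiplications with power series. (In characteristic zero the abstract ring with
`θ f = f θ + θ(f)` acts faithfully on `K[[t]]`.) -/
def diffOpAlgebra (K : Type*) [Field K] : Subalgebra K (Module.End K K⟦X⟧) :=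
  Algebra.adjoin K
    (insert (theta K).toLinearMap (Set.range (Algebra.lmul K K⟦X⟧)))

/-- The ring `K[[t]][θ]`. -/
def DiffOp (K : Type*) [Field K] : Type _ := ↥(diffOpAlgebra K)

instance : Ring (DiffOp K) := inferInstanceAs (Ring ↥(diffOpAlgebra K))

instance : Algebra K (DiffOp K) := inferInstanceAs (Algebra K ↥(diffOpAlgebra K))

/-- The tautological action of `K[[t]][θ]` on `K[[t]]`. -/
instance : Module (DiffOp K) K⟦X⟧ := inferInstanceAs (Module ↥(diffOpAlgebra K) K⟦X⟧)

/-- The inclusion `K[[t]] → K[[t]][θ]`, sending `f` to multiplication by `f`. -/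
def mulOp (K : Type*) [Field K] : K⟦X⟧ →ₐ[K] DiffOp K :=
  (Algebra.lmul K K⟦X⟧).codRestrict (diffOpAlgebra K) fun f =>
    Algebra.subset_adjoin (Set.mem_insert_of_mem _ (Set.mem_range_self f))

/-- The element `θ` of `K[[t]][θ]`. -/
def thetaOp (K : Type*) [Field K] : DiffOp K :=
  ⟨(theta K).toLinearMap, Algebra.subset_adjoin (Set.mem_insert _ _)⟩

/-- `K[[t]]` acts on `K[[t]][θ]` by left multiplication. -/
instance : Module K⟦X⟧ (DiffOp K) := Module.compHom (DiffOp K) (mulOp K).toRingHom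

instance : IsScalarTower K⟦X⟧ (DiffOp K) (DiffOp K) :=
  ⟨fun f d e => mul_assoc (mulOp K f) d e⟩

/-! ### Calabi-Yau operators

An operator `𝓛 = θ ^ n + ∑_{i < n} a_i θ ^ i` over `K(t)` is given by its order `n` and its
coefficients `a : ℕ → RatFunc K`, of which only those of index `< n` matter. -/

/-- Condition (N): the coefficients `a_i` are regular at `t = 0` and the indicial polynomial
`s ^ n + ∑ a_i(0) s ^ i` is `s ^ n`. -/
structure NullExponents (n : ℕ) (a : ℕ → RatFunc K) : Prop where
  regular : ∀ i < n, IsRegularAtZero (a i)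
  indicial : (Polynomial.X ^ n + ∑ i ∈ Finset.range n,
      Polynomial.C (PowerSeries.constantCoeff (expansion (a i))) * Polynomial.X ^ i : K[X]) =
    Polynomial.X ^ n

/-- The operator `𝓛 = θ ^ n + ∑ a_i θ ^ i` in `K[[t]][θ]`. -/
def operator (n : ℕ) (a : ℕ → RatFunc K) : DiffOp K :=
  thetaOp K ^ n + ∑ i ∈ Finset.range n, mulOp K (expansion (a i)) * thetaOp K ^ i

/-- The formal adjoint `𝓛* = (-1) ^ n θ ^ n + ∑ (-1) ^ i θ ^ i a_i` in `K[[t]][θ]`. -/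
def formalAdjoint (n : ℕ) (a : ℕ → RatFunc K) : DiffOp K :=
  (-1) ^ n * thetaOp K ^ n +
    ∑ i ∈ Finset.range n, (-1) ^ i * (thetaOp K ^ i * mulOp K (expansion (a i)))

/-- The formal integral `∫ f dt/t` without constant term (for `f` without constant term). -/
def logIntegral (f : K⟦X⟧) : K⟦X⟧ :=
  PowerSeries.mk fun k => PowerSeries.coeff k f / (k : K)

/-- `exp f ∈ 1 + t K[[t]]` for `f ∈ t K[[t]]`. -/
def expSeries [CharZero K] (f : K⟦X⟧) : K⟦X⟧ := (PowerSeries.exp K).subst f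

/-- The `β`-factor `β = exp ((2 / n) ∫ a_{n-1} dt/t) ∈ 1 + t K[[t]]`. -/
def betaFactor [CharZero K] (n : ℕ) (a : ℕ → RatFunc K) : K⟦X⟧ :=
  expSeries (PowerSeries.C (2 / (n : K)) * logIntegral (expansion (a (n - 1))))

/-- `𝓛` is Calabi-Yau: it has order `n ≥ 1`, satisfies (N), and is self-adjoint, i.e.
`𝓛* = (-1) ^ n β 𝓛 β⁻¹`. -/
structure IsCalabiYau [CharZero K] (n : ℕ) (a : ℕ → RatFunc K) : Prop where
  one_le_order : 1 ≤ n
  nullExponents : NullExponents n a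
  selfAdjoint : formalAdjoint n a =
    (-1) ^ n * (mulOp K (betaFactor n a) * operator n a * mulOp K (betaFactor n a)⁻¹)

/-! ### The lattice `Λ` -/

/-- `Λ = K[[t]][θ] / K[[t]][θ] 𝓛` (quotient by the left ideal generated by `𝓛`), a left
`K[[t]][θ]`-module and in particular a `K[[t]]`-module. -/
abbrev Lattice (n : ℕ) (a : ℕ → RatFunc K) : Type _ :=
  DiffOp K ⧸ (Submodule.span (DiffOp K) {operator n a} : Submodule (DiffOp K) (DiffOp K))

/-- `η^(j) = θ ^ j η`, where `η ∈ Λ` is the class of `1`. -/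
def eta (n : ℕ) (a : ℕ → RatFunc K) (j : ℕ) : Lattice n a :=
  thetaOp K ^ j • Submodule.Quotient.mk (1 : DiffOp K)

/-- `Fil^i ⊆ Λ` is the `K[[t]]`-span of the `η^(j)` with `0 ≤ j ≤ n - 1 - i`. -/
def Fil (n : ℕ) (a : ℕ → RatFunc K) (i : ℤ) : Submodule K⟦X⟧ (Lattice n a) :=
  Submodule.span K⟦X⟧ {x | ∃ j : ℕ, (j : ℤ) ≤ n - 1 - i ∧ x = eta n a j}

/-- A `K[[t]][θ]`-module is trivial if it is isomorphic to `K[[t]] ^ m`, with `θ` acting on each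
component by `t d/dt`, for some `m ≥ 0`. -/
def IsTrivial (M : Type*) [AddCommGroup M] [Module (DiffOp K) M] : Prop :=
  ∃ m : ℕ, Nonempty (M ≃ₗ[DiffOp K] (Fin m → K⟦X⟧))

/-- An increasing filtration of `Λ` by `K[[t]][θ]`-submodules which is opposite to `Fil`, in the
sense that `Λ = U_i ⊕ Fil^(i+1)` for all `i`, and has trivial graded pieces. -/
structure IsOppositeFiltration (n : ℕ) (a : ℕ → RatFunc K)
    (U : ℤ → Submodule (DiffOp K) (Lattice n a)) : Prop where
  mono : Monotone U
  opposite : ∀ i, IsCompl ((U i).restrictScalars K⟦X⟧) (Fil n a (i + 1))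
  trivial : ∀ i, IsTrivial (K := K) (↥(U (i + 1)) ⧸ (U i).submoduleOf (U (i + 1)))

/-! ### Solutions in `K[[t]][log t]`

The ring `K[[t]][log t]` is the polynomial ring over `K[[t]]` in the variable `log t`. -/

/-- The derivation `θ` of `K[[t]][log t]`: it extends `θ` on `K[[t]]` and `θ (log t) = 1`. -/
def thetaLog (p : K⟦X⟧[X]) : K⟦X⟧[X] :=
  (p.sum fun j f => Polynomial.monomial j (theta K f)) + Polynomial.derivative p

/-- The action of `𝓛` on `K[[t]][log t]`. -/
def applyLog (n : ℕ) (a : ℕ → RatFunc K) (p : K⟦X⟧[X]) : K⟦X⟧[X] :=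
  thetaLog^[n] p +
    ∑ i ∈ Finset.range n, Polynomial.C (expansion (a i)) * thetaLog^[i] p

/-- `F_0, …, F_{n-1} ∈ K[[t]][log t]` is a Frobenius basis of solutions of `𝓛`:
`F_0 ∈ 1 + t K[[t]]`, `𝓛 F_i = 0` and `∑_{r ≤ i} (-1) ^ r F_{i-r} (log t) ^ r / r! ∈ K[[t]]`. -/
structure IsFrobeniusBasis (n : ℕ) (a : ℕ → RatFunc K) (F : ℕ → K⟦X⟧[X]) : Prop where
  holomorphic : ∃ f : K⟦X⟧, PowerSeries.constantCoeff f = 1 ∧ F 0 = Polynomial.C f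
  solution : ∀ i < n, applyLog n a (F i) = 0
  logarithmic : ∀ i < n, ∃ g : K⟦X⟧,
    ∑ r ∈ Finset.range (i + 1),
      (-1) ^ r * F (i - r) *
        (Polynomial.C (PowerSeries.C ((r.factorial : K)⁻¹)) * Polynomial.X ^ r) =
      Polynomial.C g

/-- The wronskian `det (F_r^(s))_{0 ≤ r, s < k}` of `F_0, …, F_{k-1}`. For `k = i + 1` this is
`wr_i`, and for `k = 0` it is `wr_{-1} = 1`. -/
def wronskian (F : ℕ → K⟦X⟧[X]) (k : ℕ) : K⟦X⟧[X] :=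
  Matrix.det (Matrix.of fun r s : Fin k => thetaLog^[(s : ℕ)] (F r))

/-- The wronskian as a power series (the coefficient of `(log t) ^ 0`; that no other coefficient
occurs is part of the theorem). For `k = i + 1` this is `wr_i`, for `k = 0` it is `wr_{-1} = 1`. -/
def wr (F : ℕ → K⟦X⟧[X]) (k : ℕ) : K⟦X⟧ := (wronskian F k).coeff 0

/-- `τ_i = wr_{i-2} wr_i / wr_{i-1} ^ 2` for `i ≥ 1`. -/
def tau (F : ℕ → K⟦X⟧[X]) (i : ℕ) : K⟦X⟧ :=
  wr F (i - 1) * wr F (i + 1) * ((wr F i) ^ 2)⁻¹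

/-- `q = exp (F_1 / F_0)`, where the normalization of `F_1` is such that this makes sense in
`t + t ^ 2 K[[t]]`: `F_1 / F_0 = log t + g` with `g ∈ t K[[t]]`, and `q = t exp g`. -/
def IsQCoordinate [CharZero K] (F : ℕ → K⟦X⟧[X]) (q : K⟦X⟧) : Prop :=
  ∃ g : K⟦X⟧, PowerSeries.constantCoeff g = 0 ∧
    F 1 = F 0 * (Polynomial.X + Polynomial.C g) ∧
    q = PowerSeries.X * expSeries g

/-- The sequence `u_0, …, u_{n-1}` has the following two properties, for a family of constants
`c_0, …, c_{n-1}`: `U_i` is generated as a `K[[t]]`-module by `u_0, …, u_i`, and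
`u_i = ∑_{r ≤ n-1-i} v_{i,r} η^(r)` with `v_{i,n-1-i} = c_i β wr_i / wr_{i-1}`. -/
structure IsAdapted [CharZero K] (n : ℕ) (a : ℕ → RatFunc K)
    (U : ℤ → Submodule (DiffOp K) (Lattice n a)) (F : ℕ → K⟦X⟧[X])
    (c : Fin n → K) (u : Fin n → Lattice n a) : Prop where
  generates : ∀ i : Fin n,
    (U (i : ℕ)).restrictScalars K⟦X⟧ = Submodule.span K⟦X⟧ {x | ∃ r ≤ i, x = u r}
  leading : ∀ i : Fin n, ∃ v : ℕ → K⟦X⟧,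
    u i = ∑ r ∈ Finset.range (n - i), v r • eta n a r ∧
    v (n - 1 - i) =
      PowerSeries.C (c i) * (betaFactor n a * (wr F (i + 1) * (wr F i)⁻¹))

/-! ### Compatibility of the expansion with the inclusion in Laurent series -/

theorem coe_expansion {f : RatFunc K} (hf : IsRegularAtZero f) :
    ((expansion f : K⟦X⟧) : K⸨X⸩) = (f : K⸨X⸩) := by
  obtain ⟨A, hA⟩ := hf
  have hd0 : (algebraMap K[X] (RatFunc K)) f.denom ≠ 0 := by
    simpa using f.denom_ne_zero
  have hfd : f * (algebraMap K[X] (RatFunc K)) f.denom = (algebraMap K[X] (RatFunc K)) f.num := by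
    rw [eq_comm, ← div_eq_iff hd0, RatFunc.num_div_denom]
  have hAd : A * (f.denom : K⟦X⟧) = (f.num : K⟦X⟧) := by
    apply HahnSeries.ofPowerSeries_injective (Γ := ℤ) (R := K)
    rw [map_mul]
    erw [hA, RatFunc.coe_coe, RatFunc.coe_coe]
    rw [← map_mul]
    exact congrArg _ hfd
  have hd : PowerSeries.constantCoeff (f.denom : K⟦X⟧) ≠ 0 := by
    intro h
    have h1 : Polynomial.X ∣ f.denom := by
      rw [Polynomial.X_dvd_iff]; simpa using h
    have h2 : Polynomial.X ∣ f.num := by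
      rw [Polynomial.X_dvd_iff]
      have := congrArg PowerSeries.constantCoeff hAd
      rw [map_mul, h, mul_zero] at this
      simpa using this.symm
    exact Polynomial.not_isUnit_X ((RatFunc.isCoprime_num_denom f).isUnit_of_dvd' h2 h1)
  have : expansion f = A := by
    rw [expansion, ← hAd, mul_assoc, PowerSeries.mul_inv_cancel _ hd, mul_one]
  rw [this, hA]

end CalabiYauODE

end

/-! Write logarithmic solutions as F_i = Σ_r g_{i-r} (log t)^r / r!. Applying θ to F_i then amounts
to applying θ + N to the sequence g, where N is the shift (`thetaLog_logSeries`). A Frobenius basis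
is thus a single solution g of 𝓛 for the connection θ + N, read in the components below n.
Frobenius's method with a formal exponent produces one (`exists_jordanSolution`).

Sending η to g gives flat coordinates on Λ (`flatCoord`). In the first k of them, η^(0), …, η^(k-1)
have the matrix `jordanMatrix g k`. At t = 0 it is triangular with ones on the diagonal, so its
determinant is a unit; this determinant is wr_{k-1}, since the logarithms contribute only a
unipotent factor (`wronskian_eq`). Hence the θ-stable submodule `flatSub` where the first k
coordinates vanish is a complement of the span of the η^(j), j < k. The filtration is U_i = {first
n-1-i coordinates vanish}. It is the only one, because an element whose θ-derivative has k vanishing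
coordinates has k-1 of them vanishing itself (`mem_flatSub_of_thetaOp`).

The element u_i lies in U_i and in the span of η^(0), …, η^(n-1-i), with flat coordinate n-1-i equal
to 1. Cramer's rule gives it the leading coefficient wr_{n-2-i} / wr_{n-1-i}. Self-adjointness
converts this into β wr_i / wr_{i-1}: it yields a horizontal pairing on Λ which is antitriangular in
the η^(j) and, in the opposite sense, in the flat basis, and comparing the antidiagonals gives
`det_jordanMatrix_symm`. Finally, θ u_{i+1} and τ_{i+1} u_i lie in U_i and have the same leading
term, so the complement property makes them equal. -/

noncomputable section

namespace CalabiYauODE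

variable {K : Type*} [Field K]

/-! ### Structure of the ring of differential operators -/

theorem theta_apply (f : K⟦X⟧) : theta K f = PowerSeries.X * PowerSeries.derivative K f := rfl

@[simp]
theorem coeff_theta (m : ℕ) (f : K⟦X⟧) :
    PowerSeries.coeff m (theta K f) = m * PowerSeries.coeff m f := by
  rw [theta_apply]
  cases m with
  | zero => simp
  | succ m =>
    rw [PowerSeries.coeff_succ_X_mul]
    simp [mul_comm, PowerSeries.coeff_derivative]

theorem constantCoeff_theta (f : K⟦X⟧) : PowerSeries.constantCoeff (theta K f) = 0 := by
  rw [← PowerSeries.coeff_zero_eq_constantCoeff_apply, coeff_theta]; simp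

theorem theta_eq_zero [CharZero K] {f : K⟦X⟧} (h : theta K f = 0) :
    f = PowerSeries.C (PowerSeries.constantCoeff f) := by
  ext m
  have := congrArg (PowerSeries.coeff m) h
  rw [coeff_theta] at this
  cases m with
  | zero => simp
  | succ m =>
    have h2 : ((m + 1 : ℕ) : K) ≠ 0 := Nat.cast_ne_zero.2 m.succ_ne_zero
    rw [PowerSeries.coeff_C]
    simpa [h2, -Nat.cast_add] using this

theorem mulOp_smul (f g : K⟦X⟧) : mulOp K f • g = f * g := rfl

theorem thetaOp_smul (g : K⟦X⟧) : thetaOp K • g = theta K g := rfl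

theorem smul_def (f : K⟦X⟧) (d : DiffOp K) : f • d = mulOp K f * d := rfl

theorem diffOp_ext {d e : DiffOp K} (h : ∀ f : K⟦X⟧, d • f = e • f) : d = e :=
  Subtype.ext (LinearMap.ext h)

theorem thetaOp_mul_mulOp (f : K⟦X⟧) :
    thetaOp K * mulOp K f = mulOp K f * thetaOp K + mulOp K (theta K f) := by
  apply diffOp_ext
  intro g
  rw [mul_smul, add_smul, mul_smul]
  simp only [mulOp_smul, thetaOp_smul]
  rw [Derivation.leibniz, smul_eq_mul, smul_eq_mul, mul_comm g]

theorem thetaOp_mul_smul (f : K⟦X⟧) (d : DiffOp K) :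
    thetaOp K * f • d = f • (thetaOp K * d) + theta K f • d := by
  simp only [smul_def, ← mul_assoc, thetaOp_mul_mulOp, add_mul]

theorem diffOp_induction {p : DiffOp K → Prop} (hmul : ∀ f, p (mulOp K f)) (htheta : p (thetaOp K))
    (hadd : ∀ d e, p d → p e → p (d + e)) (hprod : ∀ d e, p d → p e → p (d * e))
    (d : DiffOp K) : p d := by
  obtain ⟨d, hd⟩ := d
  induction hd using Algebra.adjoin_induction with
  | mem x hx =>
    rcases hx with rfl | ⟨f, rfl⟩
    · exact htheta
    · exact hmul f
  | algebraMap r =>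
    have h : mulOp K (PowerSeries.C r) =
        (⟨algebraMap K _ r, algebraMap_mem _ r⟩ : ↥(diffOpAlgebra K)) := by
      apply diffOp_ext
      intro f
      rw [mulOp_smul, ← PowerSeries.smul_eq_C_mul]
      rfl
    exact h ▸ hmul (PowerSeries.C r)
  | add x y hx hy h1 h2 => exact hadd _ _ h1 h2
  | mul x y hx hy h1 h2 => exact hprod _ _ h1 h2

theorem coeff_thetaOp_pow_smul (i m : ℕ) (f : K⟦X⟧) :
    PowerSeries.coeff m ((thetaOp K ^ i) • f) = (m : K) ^ i * PowerSeries.coeff m f := by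
  induction i with
  | zero => simp
  | succ i ih => rw [pow_succ', mul_smul, thetaOp_smul, coeff_theta, ih]; ring

theorem thetaOp_pow_smul_X_pow (i k : ℕ) :
    (thetaOp K ^ i) • (PowerSeries.X ^ k : K⟦X⟧) = PowerSeries.C ((k : K) ^ i) * PowerSeries.X ^ k := by
  ext m
  rw [coeff_thetaOp_pow_smul, PowerSeries.coeff_C_mul, PowerSeries.coeff_X_pow]
  split_ifs with h <;> simp [h]

/-- Applying a relation Σ c_j θ^j = 0 to t^k gives Σ c_j k^j = 0, so a polynomial over K[[t]] has
every natural number as a root. -/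
theorem linearIndependent_thetaOp_pow [CharZero K] :
    LinearIndependent K⟦X⟧ fun i : ℕ => thetaOp K ^ i := by
  rw [linearIndependent_iff']
  intro s c hc i hi
  have key : ∀ k : ℕ, ∑ j ∈ s, c j * PowerSeries.C ((k : K) ^ j) = 0 := by
    intro k
    have h1 := congrArg (fun d : DiffOp K => d • (PowerSeries.X ^ k : K⟦X⟧)) hc
    simp only [Finset.sum_smul, zero_smul, smul_def, mul_smul, mulOp_smul,
      thetaOp_pow_smul_X_pow, ← mul_assoc] at h1
    rw [← Finset.sum_mul] at h1
    exact (mul_eq_zero.1 h1).resolve_right (pow_ne_zero _ PowerSeries.X_ne_zero)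
  have hp : (∑ j ∈ s, Polynomial.monomial j (c j) : K⟦X⟧[X]) = 0 := by
    apply Polynomial.eq_zero_of_infinite_isRoot
    apply Set.Infinite.mono (s := Set.range fun k : ℕ => (k : K⟦X⟧))
    · rintro _ ⟨k, rfl⟩
      have := key k
      simp only [map_pow, map_natCast] at this
      simpa [Polynomial.IsRoot, Polynomial.eval_finsetSum] using this
    · have : CharZero K⟦X⟧ := charZero_of_injective_ringHom (f := PowerSeries.C) PowerSeries.C_injective
      exact Set.infinite_range_of_injective Nat.cast_injective
  have := congrArg (fun p => Polynomial.coeff p i) hp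
  simpa [Polynomial.finsetSum_coeff, Polynomial.coeff_monomial, hi] using this

theorem span_thetaOp_pow :
    Submodule.span K⟦X⟧ (Set.range fun i : ℕ => thetaOp K ^ i) = ⊤ := by
  rw [eq_top_iff]
  have key : ∀ d : DiffOp K, ∀ e ∈ Submodule.span K⟦X⟧ (Set.range fun i : ℕ => thetaOp K ^ i),
      d * e ∈ Submodule.span K⟦X⟧ (Set.range fun i : ℕ => thetaOp K ^ i) := by
    intro d
    induction d using diffOp_induction with
    | hmul f => intro e he; exact Submodule.smul_mem _ f he
    | htheta =>
      intro e he
      induction he using Submodule.span_induction with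
      | mem x hx =>
        obtain ⟨i, rfl⟩ := hx
        exact Submodule.subset_span ⟨i + 1, pow_succ' _ _⟩
      | zero => simp
      | add x y _ _ hx hy => rw [mul_add]; exact add_mem hx hy
      | smul f x hx h =>
        rw [thetaOp_mul_smul]
        exact add_mem (Submodule.smul_mem _ _ h) (Submodule.smul_mem _ _ hx)
    | hadd d e hd he => intro x hx; rw [add_mul]; exact add_mem (hd x hx) (he x hx)
    | hprod d e hd he => intro x hx; rw [mul_assoc]; exact hd _ (he x hx)
  intro d _
  have := key d 1 (Submodule.subset_span ⟨0, pow_zero _⟩)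
  rwa [mul_one] at this

/-- The powers of `θ` form a basis of `K[[t]][θ]` as a left `K[[t]]`-module. -/
def thetaBasis (K : Type*) [Field K] [CharZero K] : Module.Basis ℕ K⟦X⟧ (DiffOp K) :=
  Module.Basis.mk linearIndependent_thetaOp_pow span_thetaOp_pow.ge

/-! ### Modules with connection -/

section Connection

variable {M : Type*} [AddCommGroup M] [Module K⟦X⟧ M]

/-- An additive endomorphism satisfying the Leibniz rule over `θ`. -/
def IsConnection (D : AddMonoid.End M) : Prop :=
  ∀ (f : K⟦X⟧) (m : M), D (f • m) = f • D m + theta K f • m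

/-- The action of `K[[t]][θ]` on a module with connection. -/
def connAct [CharZero K] (D : AddMonoid.End M) : DiffOp K →ₗ[K⟦X⟧] AddMonoid.End M :=
  (thetaBasis K).constr ℕ fun i => D ^ i

variable [CharZero K] {D : AddMonoid.End M}

theorem connAct_pow (D : AddMonoid.End M) (i : ℕ) : connAct (K := K) D (thetaOp K ^ i) = D ^ i := by
  have : thetaOp K ^ i = thetaBasis K i := by rw [thetaBasis, Module.Basis.mk_apply]
  rw [this, connAct, Module.Basis.constr_basis]

theorem connAct_one (D : AddMonoid.End M) (m : M) : connAct (K := K) D 1 m = m := by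
  rw [← pow_zero (thetaOp K), connAct_pow]; rfl

theorem connAct_thetaOp (D : AddMonoid.End M) : connAct (K := K) D (thetaOp K) = D := by
  rw [← pow_one (thetaOp K), connAct_pow, pow_one]

theorem connAct_smul (D : AddMonoid.End M) (f : K⟦X⟧) (d : DiffOp K) (m : M) :
    connAct D (f • d) m = f • connAct D d m := by
  rw [map_smul]; rfl

theorem connAct_add (D : AddMonoid.End M) (d e : DiffOp K) (m : M) :
    connAct D (d + e) m = connAct D d m + connAct D e m := by
  rw [map_add]; rfl

theorem connAct_sum (D : AddMonoid.End M) {ι : Type*} (s : Finset ι) (d : ι → DiffOp K) (m : M) :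
    connAct D (∑ i ∈ s, d i) m = ∑ i ∈ s, connAct D (d i) m := by
  rw [map_sum]; exact AddMonoidHom.finsetSum_apply _ _ _

theorem end_pow_succ_apply (D : AddMonoid.End M) (s : ℕ) (m : M) :
    (D ^ (s + 1)) m = D ((D ^ s) m) := by
  rw [pow_succ']; rfl

theorem connAct_mulOp (D : AddMonoid.End M) (f : K⟦X⟧) (m : M) :
    connAct D (mulOp K f) m = f • m := by
  rw [← mul_one (mulOp K f), ← smul_def, connAct_smul, connAct_one]

theorem connAct_thetaOp_mul (hD : IsConnection (K := K) D) (d : DiffOp K) (m : M) :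
    connAct D (thetaOp K * d) m = D (connAct D d m) := by
  have hd : d ∈ Submodule.span K⟦X⟧ (Set.range fun i : ℕ => thetaOp K ^ i) := by
    rw [span_thetaOp_pow]; trivial
  induction hd using Submodule.span_induction with
  | mem x hx =>
    obtain ⟨i, rfl⟩ := hx
    simp only [← pow_succ', connAct_pow]
    rw [pow_succ']; rfl
  | zero => simp
  | add x y _ _ hx hy => rw [mul_add, connAct_add, connAct_add, map_add, hx, hy]
  | smul f x hx h =>
    rw [thetaOp_mul_smul, connAct_add, connAct_smul, connAct_smul,
      connAct_smul, hD, h]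

/-- `connAct` is prescribed only on the basis of powers of θ; the Leibniz rule for D matches the
commutation rule of K[[t]][θ] and makes it an action. Solutions of 𝓛 thereby make sense in any
module with connection. -/
theorem connAct_mul (hD : IsConnection (K := K) D) (d e : DiffOp K) (m : M) :
    connAct D (d * e) m = connAct D d (connAct D e m) := by
  induction d using diffOp_induction generalizing e m with
  | hmul f => rw [← smul_def, connAct_smul, connAct_mulOp]
  | htheta => rw [connAct_thetaOp_mul hD, connAct_thetaOp]
  | hadd d d' h1 h2 => simp only [add_mul, connAct_add, h1, h2]
  | hprod d d' h1 h2 => rw [mul_assoc, h1, h1, h2]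

end Connection

/-- An additive map which commutes with `K[[t]]` and with `θ` is `K[[t]][θ]`-linear. -/
def diffOpLinear {M N : Type*} [AddCommGroup M] [Module (DiffOp K) M] [AddCommGroup N]
    [Module (DiffOp K) N] (φ : M →+ N) (h1 : ∀ f m, φ (mulOp K f • m) = mulOp K f • φ m)
    (h2 : ∀ m, φ (thetaOp K • m) = thetaOp K • φ m) : M →ₗ[DiffOp K] N where
  toFun := φ
  map_add' := φ.map_add
  map_smul' d m := by
    simp only [RingHom.id_apply]
    induction d using diffOp_induction generalizing m with
    | hmul f => exact h1 f m
    | htheta => exact h2 m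
    | hadd d e hd he => rw [add_smul, map_add, hd, he, add_smul]
    | hprod d e hd he => rw [mul_smul, hd, he, mul_smul]

/-! ### The operator on a module with connection -/

theorem constantCoeff_expansion_eq_zero {n : ℕ} {a : ℕ → RatFunc K} (h : NullExponents n a) {i : ℕ}
    (hi : i < n) : PowerSeries.constantCoeff (expansion (a i)) = 0 := by
  have := congrArg (fun p => Polynomial.coeff p i) h.indicial
  simpa [Polynomial.coeff_X_pow, hi, hi.ne] using this

theorem connAct_operator [CharZero K] {M : Type*} [AddCommGroup M] [Module K⟦X⟧ M]
    (D : AddMonoid.End M) (n : ℕ) (a : ℕ → RatFunc K) (m : M) :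
    connAct D (operator n a) m =
      (D ^ n) m + ∑ i ∈ Finset.range n, expansion (a i) • (D ^ i) m := by
  rw [operator, connAct_add, connAct_pow, connAct_sum]
  congr 1
  refine Finset.sum_congr rfl fun i _ => ?_
  rw [← smul_def, connAct_smul, connAct_pow]

/-! ### The Jordan connection -/

/-- The connection `θ + N` on sequences of power series, `N` being the shift. -/
def jordan (K : Type*) [Field K] : AddMonoid.End (ℕ → K⟦X⟧) where
  toFun y k := theta K (y k) + Nat.casesOn k 0 y
  map_zero' := by ext1 k; cases k <;> simp
  map_add' y z := by
    ext1 k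
    cases k with
    | zero => simp
    | succ k => simp only [Pi.add_apply, map_add]; abel

theorem jordan_zero (y : ℕ → K⟦X⟧) : jordan K y 0 = theta K (y 0) := add_zero _

theorem jordan_succ (y : ℕ → K⟦X⟧) (k : ℕ) :
    jordan K y (k + 1) = theta K (y (k + 1)) + y k := rfl

theorem isConnection_jordan : IsConnection (K := K) (jordan K) := by
  intro f y
  ext1 k
  cases k with
  | zero =>
    simp only [jordan_zero, Pi.smul_apply, Pi.add_apply, Derivation.leibniz, smul_eq_mul]
    ring
  | succ k =>
    simp only [jordan_succ, Pi.smul_apply, Pi.add_apply, Derivation.leibniz, smul_eq_mul]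
    ring

/-- At t = 0 the image of θ vanishes, so θ + N reduces to the shift N. -/
theorem constantCoeff_jordan_pow (y : ℕ → K⟦X⟧) (s r : ℕ) :
    PowerSeries.constantCoeff ((jordan K ^ s) y r) =
      if s ≤ r then PowerSeries.constantCoeff (y (r - s)) else 0 := by
  induction s generalizing r with
  | zero => simp
  | succ s ih =>
    rw [end_pow_succ_apply]
    cases r with
    | zero => rw [jordan_zero, constantCoeff_theta]; simp
    | succ r => rw [jordan_succ, map_add, constantCoeff_theta, zero_add, ih]; simp

/-- The matrix of the first `k` components of the iterated derivatives of `g`. -/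
def jordanMatrix (g : ℕ → K⟦X⟧) (k : ℕ) : Matrix (Fin k) (Fin k) K⟦X⟧ :=
  Matrix.of fun r s => (jordan K ^ (s : ℕ)) g r

theorem constantCoeff_det_jordanMatrix {g : ℕ → K⟦X⟧} (hg : PowerSeries.constantCoeff (g 0) = 1)
    (k : ℕ) : PowerSeries.constantCoeff (jordanMatrix g k).det = 1 := by
  rw [RingHom.map_det, Matrix.det_of_isLowerTriangular]
  · apply Finset.prod_eq_one
    intro i _
    change PowerSeries.constantCoeff ((jordan K ^ (i : ℕ)) g i) = 1
    rw [constantCoeff_jordan_pow]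
    simp [hg]
  · intro i j hij
    have : (i : ℕ) < j := hij
    change PowerSeries.constantCoeff ((jordan K ^ (j : ℕ)) g i) = 0
    rw [constantCoeff_jordan_pow, if_neg this.not_ge]

theorem isUnit_det_jordanMatrix {g : ℕ → K⟦X⟧} (hg : PowerSeries.constantCoeff (g 0) = 1)
    (k : ℕ) : IsUnit (jordanMatrix g k).det := by
  rw [PowerSeries.isUnit_iff_constantCoeff, constantCoeff_det_jordanMatrix hg]
  exact isUnit_one

/-! ### Sequences of power series and logarithmic series -/

theorem thetaLog_coeff (p : K⟦X⟧[X]) (r : ℕ) :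
    (thetaLog p).coeff r = theta K (p.coeff r) + p.coeff (r + 1) * (r + 1) := by
  rw [thetaLog, Polynomial.coeff_add, Polynomial.coeff_derivative, Polynomial.sum_def,
    Polynomial.finsetSum_coeff]
  congr 1
  simp only [Polynomial.coeff_monomial]
  rw [Finset.sum_ite_eq']
  split_ifs with h
  · rfl
  · rw [Polynomial.notMem_support_iff.1 h, map_zero]

/-- `∑_{r ≤ i} y_{i-r} (log t) ^ r / r!`. -/
def logSeries (i : ℕ) : (ℕ → K⟦X⟧) →ₗ[K⟦X⟧] K⟦X⟧[X] where
  toFun y := ∑ r ∈ Finset.range (i + 1), Polynomial.monomial r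
    (PowerSeries.C ((r.factorial : K)⁻¹) * y (i - r))
  map_add' y z := by simp only [Pi.add_apply, mul_add, map_add, Finset.sum_add_distrib]
  map_smul' f y := by
    simp only [Pi.smul_apply, smul_eq_mul, RingHom.id_apply, Finset.smul_sum,
      Polynomial.smul_monomial]
    exact Finset.sum_congr rfl fun r _ => congrArg _ (by ring)

theorem logSeries_apply (i : ℕ) (y : ℕ → K⟦X⟧) :
    logSeries i y = ∑ r ∈ Finset.range (i + 1), Polynomial.monomial r
      (PowerSeries.C ((r.factorial : K)⁻¹) * y (i - r)) := rfl

theorem coeff_logSeries (i : ℕ) (y : ℕ → K⟦X⟧) (r : ℕ) :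
    (logSeries i y).coeff r =
      if r ≤ i then PowerSeries.C ((r.factorial : K)⁻¹) * y (i - r) else 0 := by
  rw [logSeries_apply, Polynomial.finsetSum_coeff]
  simp only [Polynomial.coeff_monomial]
  rw [Finset.sum_ite_eq']
  simp

/-- θ sends (log t)^r / r! to (log t)^(r-1) / (r-1)!, which is the shift on sequences. -/
theorem thetaLog_logSeries [CharZero K] (i : ℕ) (y : ℕ → K⟦X⟧) :
    thetaLog (logSeries i y) = logSeries i (jordan K y) := by
  ext1 r
  have hC : ∀ (c : K) (f : K⟦X⟧), theta K (PowerSeries.C c * f) = PowerSeries.C c * theta K f := by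
    intro c f
    rw [← PowerSeries.smul_eq_C_mul, Derivation.map_smul, PowerSeries.smul_eq_C_mul]
  have hfac : (PowerSeries.C (((r + 1).factorial : K)⁻¹) : K⟦X⟧) * (r + 1) =
      PowerSeries.C ((r.factorial : K)⁻¹) := by
    have h1 : ((r : K⟦X⟧) + 1) = PowerSeries.C ((r : K) + 1) := by simp
    rw [h1, ← map_mul, Nat.factorial_succ]
    congr 1
    have := Nat.cast_add_one_ne_zero (R := K) r
    have := Nat.cast_ne_zero (R := K).2 r.factorial_ne_zero
    push_cast
    field_simp
  rw [thetaLog_coeff, coeff_logSeries, coeff_logSeries, coeff_logSeries]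
  rcases lt_trichotomy r i with h | h | h
  · obtain ⟨k, rfl⟩ := Nat.exists_eq_add_of_lt h
    rw [if_pos h.le, if_pos (by omega), if_pos h.le, show r + k + 1 - r = k + 1 by omega,
      show r + k + 1 - (r + 1) = k by omega, jordan_succ, hC, mul_right_comm, hfac, mul_add]
  · subst h
    simp [jordan_zero, hC]
  · rw [if_neg (by omega), if_neg (by omega), if_neg (by omega)]; simp

theorem thetaLog_iterate_logSeries [CharZero K] (s i : ℕ) (y : ℕ → K⟦X⟧) :
    thetaLog^[s] (logSeries i y) = logSeries i ((jordan K ^ s) y) := by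
  induction s with
  | zero => simp
  | succ s ih => rw [Function.iterate_succ_apply', ih, thetaLog_logSeries, pow_succ']; rfl

theorem applyLog_logSeries [CharZero K] (n : ℕ) (a : ℕ → RatFunc K) (i : ℕ) (y : ℕ → K⟦X⟧) :
    applyLog n a (logSeries i y) = logSeries i (connAct (jordan K) (operator n a) y) := by
  rw [applyLog, connAct_operator, map_add, map_sum, thetaLog_iterate_logSeries]
  congr 1
  refine Finset.sum_congr rfl fun j _ => ?_
  rw [map_smul, thetaLog_iterate_logSeries, Polynomial.smul_eq_C_mul]

/-- The factor `(log t) ^ r / r!`. -/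
def logPow (K : Type*) [Field K] (r : ℕ) : K⟦X⟧[X] :=
  Polynomial.C (PowerSeries.C ((r.factorial : K)⁻¹)) * Polynomial.X ^ r

/-- In generating series with an auxiliary variable z, the two convolutions are multiplication by
the mutually inverse series exp(-z log t) and exp(z log t). -/
theorem logPow_convolution [CharZero K] (F G : ℕ → K⟦X⟧[X]) :
    (∀ i, G i = ∑ r ∈ Finset.range (i + 1), (-1) ^ r * F (i - r) * logPow K r) ↔
      ∀ i, F i = ∑ r ∈ Finset.range (i + 1), G (i - r) * logPow K r := by
  set E : K⟦X⟧[X]⟦X⟧ := PowerSeries.rescale Polynomial.X (PowerSeries.exp K⟦X⟧[X]) with hE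
  set E' : K⟦X⟧[X]⟦X⟧ := PowerSeries.rescale (Polynomial.X : K⟦X⟧[X])
    (PowerSeries.evalNegHom (PowerSeries.exp K⟦X⟧[X])) with hE'
  have hEE : E * E' = 1 := by
    rw [hE, hE', ← map_mul, PowerSeries.exp_mul_exp_neg_eq_one, map_one]
  have halg : ∀ r : ℕ, algebraMap ℚ K⟦X⟧[X] (1 / (r.factorial : ℚ)) =
      Polynomial.C (PowerSeries.C ((r.factorial : K)⁻¹)) := by
    intro r
    have h2 := RingHom.congr_fun (Subsingleton.elim (algebraMap ℚ K⟦X⟧[X])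
      (Polynomial.C.comp (PowerSeries.C.comp (algebraMap ℚ K)))) (1 / (r.factorial : ℚ))
    rw [h2]
    simp
  have hEr : ∀ r, PowerSeries.coeff r E = logPow K r := by
    intro r
    rw [hE, PowerSeries.coeff_rescale, PowerSeries.coeff_exp, halg, logPow, mul_comm]
  have hEr' : ∀ r, PowerSeries.coeff r E' = (-1) ^ r * logPow K r := by
    intro r
    rw [hE', PowerSeries.coeff_rescale, PowerSeries.evalNegHom, PowerSeries.coeff_rescale,
      PowerSeries.coeff_exp, halg, logPow]
    ring
  have h1 : (∀ i, G i = ∑ r ∈ Finset.range (i + 1), (-1) ^ r * F (i - r) * logPow K r) ↔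
      PowerSeries.mk G = E' * PowerSeries.mk F := by
    rw [PowerSeries.ext_iff]
    refine forall_congr' fun i => ?_
    rw [PowerSeries.coeff_mk, PowerSeries.coeff_mul,
      Finset.Nat.sum_antidiagonal_eq_sum_range_succ
        (fun p q => PowerSeries.coeff p E' * PowerSeries.coeff q (PowerSeries.mk F))]
    simp only [hEr', PowerSeries.coeff_mk]
    simp only [mul_right_comm]
  have h2 : (∀ i, F i = ∑ r ∈ Finset.range (i + 1), G (i - r) * logPow K r) ↔
      PowerSeries.mk F = E * PowerSeries.mk G := by
    rw [PowerSeries.ext_iff]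
    refine forall_congr' fun i => ?_
    rw [PowerSeries.coeff_mk, PowerSeries.coeff_mul,
      Finset.Nat.sum_antidiagonal_eq_sum_range_succ
        (fun p q => PowerSeries.coeff p E * PowerSeries.coeff q (PowerSeries.mk G))]
    simp only [hEr, PowerSeries.coeff_mk]
    simp only [mul_comm]
  rw [h1, h2]
  constructor
  · intro h; rw [h, ← mul_assoc, hEE, one_mul]
  · intro h; rw [h, ← mul_assoc, mul_comm E', hEE, one_mul]

theorem logSeries_eq_sum (i : ℕ) (y : ℕ → K⟦X⟧) :
    logSeries i y = ∑ r ∈ Finset.range (i + 1), Polynomial.C (y (i - r)) * logPow K r := by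
  rw [logSeries_apply]
  refine Finset.sum_congr rfl fun r _ => ?_
  rw [logPow, ← mul_assoc, ← map_mul, Polynomial.C_mul_X_pow_eq_monomial, mul_comm]

theorem coeff_zero_logSeries (i : ℕ) (y : ℕ → K⟦X⟧) : (logSeries i y).coeff 0 = y i := by
  simp [coeff_logSeries]

/-- The sequence `g` underlies a Frobenius basis: it is a solution of the truncated Jordan
system. -/
structure IsJordanSolution [CharZero K] (n : ℕ) (a : ℕ → RatFunc K) (g : ℕ → K⟦X⟧) : Prop where
  constantCoeff : PowerSeries.constantCoeff (g 0) = 1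
  solution : ∀ k < n, connAct (jordan K) (operator n a) g k = 0

theorem IsFrobeniusBasis.exists_jordanSolution [CharZero K] {n : ℕ} {a : ℕ → RatFunc K}
    (hn : 1 ≤ n) {F : ℕ → K⟦X⟧[X]} (hF : IsFrobeniusBasis n a F) :
    ∃ g, IsJordanSolution n a g ∧ ∀ i < n, F i = logSeries i g := by
  let G : ℕ → K⟦X⟧[X] := fun i =>
    ∑ r ∈ Finset.range (i + 1), (-1) ^ r * F (i - r) * logPow K r
  have hFG := (logPow_convolution F G).1 fun i => rfl
  have hG : ∀ i < n, G i = Polynomial.C ((G i).coeff 0) := by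
    intro i hi
    obtain ⟨g, hg⟩ := hF.logarithmic i hi
    have : G i = Polynomial.C g := hg
    rw [this, Polynomial.coeff_C_zero]
  have hFi : ∀ i < n, F i = logSeries i fun k => (G k).coeff 0 := by
    intro i hi
    rw [hFG i, logSeries_eq_sum]
    refine Finset.sum_congr rfl fun r _ => ?_
    rw [← hG _ (by omega)]
  -- From index n on, F is unconstrained and these entries are meaningless; only the components
  -- below n are used.
  refine ⟨fun k => (G k).coeff 0, ⟨?_, ?_⟩, hFi⟩
  · obtain ⟨f, hf, hf0⟩ := hF.holomorphic
    have := hFi 0 (by omega)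
    rw [hf0] at this
    have := congrArg (fun p => Polynomial.coeff p 0) this
    simp only [coeff_zero_logSeries, Polynomial.coeff_C_zero] at this
    rw [← this, hf]
  · intro k hk
    have := hF.solution k hk
    rw [hFi k hk, applyLog_logSeries] at this
    exact (coeff_zero_logSeries k _).symm.trans (by rw [this, Polynomial.coeff_zero])

theorem IsJordanSolution.isFrobeniusBasis [CharZero K] {n : ℕ} {a : ℕ → RatFunc K}
    {g : ℕ → K⟦X⟧} (hg : IsJordanSolution n a g) :
    IsFrobeniusBasis n a fun i => logSeries i g := by
  refine ⟨⟨g 0, hg.constantCoeff, by simp [logSeries_apply]⟩, ?_, ?_⟩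
  · intro i hi
    rw [applyLog_logSeries, logSeries_apply]
    refine Finset.sum_eq_zero fun r _ => ?_
    rw [hg.solution _ (by omega), mul_zero, map_zero]
  · intro i _
    refine ⟨g i, ?_⟩
    exact ((logPow_convolution (fun i => logSeries i g) (fun i => Polynomial.C (g i))).2
      (fun i => logSeries_eq_sum i g) i).symm

/-- All logarithms sit in a lower triangular factor with ones on the diagonal, so they disappear
from the determinant. -/
theorem wronskian_eq [CharZero K] {n : ℕ} {F : ℕ → K⟦X⟧[X]} {g : ℕ → K⟦X⟧}
    (hF : ∀ i < n, F i = logSeries i g) {k : ℕ} (hk : k ≤ n) :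
    wronskian F k = Polynomial.C (jordanMatrix g k).det := by
  let E : Matrix (Fin k) (Fin k) K⟦X⟧[X] :=
    Matrix.of fun r q => if q ≤ r then logPow K (r - q) else 0
  have hE : E.det = 1 := by
    rw [Matrix.det_of_isLowerTriangular]
    · apply Finset.prod_eq_one
      intro i _
      simp [E, logPow]
    · intro i j hij
      have : i < j := hij
      simp [E, this]
  have hM : (Matrix.of fun r s : Fin k => thetaLog^[(s : ℕ)] (F r)) =
      E * (jordanMatrix g k).map Polynomial.C := by
    ext1 r s
    rw [Matrix.of_apply, hF r (by omega), thetaLog_iterate_logSeries, Matrix.mul_apply,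
      logSeries_eq_sum]
    simp only [E, Matrix.of_apply, Matrix.map_apply, jordanMatrix, ite_mul, zero_mul]
    rw [← Finset.sum_range_reflect, Finset.sum_ite, Finset.sum_const_zero, add_zero]
    symm
    refine Finset.sum_bij (fun q _ => (q : ℕ)) ?_ ?_ ?_ ?_
    · intro q hq
      simp only [Finset.mem_filter, Finset.mem_univ, true_and] at hq
      have : (q : ℕ) ≤ r := hq
      simp; omega
    · intro q _ q' _ h; exact Fin.ext h
    · intro q hq
      rw [Finset.mem_range] at hq
      refine ⟨⟨q, by omega⟩, ?_, rfl⟩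
      simp only [Finset.mem_filter, Finset.mem_univ, true_and, Fin.le_def]
      omega
    · intro q hq
      simp only [Finset.mem_filter, Finset.mem_univ, true_and] at hq
      have : (q : ℕ) ≤ r := hq
      rw [mul_comm, show (r : ℕ) - (r + 1 - 1 - q) = q by omega,
        show (r : ℕ) + 1 - 1 - q = r - q by omega]
  rw [wronskian, hM, Matrix.det_mul, hE, one_mul, RingHom.map_det]
  rfl

theorem wr_eq [CharZero K] {n : ℕ} {F : ℕ → K⟦X⟧[X]} {g : ℕ → K⟦X⟧}
    (hF : ∀ i < n, F i = logSeries i g) {k : ℕ} (hk : k ≤ n) :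
    wr F k = (jordanMatrix g k).det := by
  rw [wr, wronskian_eq hF hk, Polynomial.coeff_C_zero]

/-! ### Existence of a solution -/

/-- The coefficients of the Frobenius solution, as power series in the exponent. -/
def frobeniusCoeff (n : ℕ) (A : ℕ → K⟦X⟧) : ℕ → K⟦X⟧
  | 0 => 1
  | m + 1 => -((((m + 1 : ℕ) : K⟦X⟧) + PowerSeries.X) ^ n)⁻¹ * ∑ l : Fin (m + 1),
      ∑ i ∈ Finset.range n, PowerSeries.C (PowerSeries.coeff (m + 1 - l) (A i)) *
        ((((l : ℕ) : K⟦X⟧) + PowerSeries.X) ^ i * frobeniusCoeff n A l)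
termination_by m => m
decreasing_by exact l.2

theorem frobeniusCoeff_rec [CharZero K] (n : ℕ) (A : ℕ → K⟦X⟧) (m : ℕ) :
    (((m + 1 : ℕ) : K⟦X⟧) + PowerSeries.X) ^ n * frobeniusCoeff n A (m + 1) +
      ∑ l ∈ Finset.range (m + 1), ∑ i ∈ Finset.range n,
        PowerSeries.C (PowerSeries.coeff (m + 1 - l) (A i)) *
          (((l : K⟦X⟧) + PowerSeries.X) ^ i * frobeniusCoeff n A l) = 0 := by
  have h : PowerSeries.constantCoeff ((((m + 1 : ℕ) : K⟦X⟧) + PowerSeries.X) ^ n) ≠ 0 := by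
    rw [map_pow, map_add, PowerSeries.constantCoeff_X, add_zero, map_natCast]
    exact pow_ne_zero _ (Nat.cast_ne_zero.2 m.succ_ne_zero)
  rw [frobeniusCoeff, ← mul_assoc, mul_neg, PowerSeries.mul_inv_cancel _ h, Finset.sum_range]
  ring

/-- The sequence of power series with given generating series of `m`-th coefficients. -/
def ofCoeff (c : ℕ → K⟦X⟧) : ℕ → K⟦X⟧ := fun k =>
  PowerSeries.mk fun m => PowerSeries.coeff k (c m)

/-- Read the sequence as Σ_m c_m(ε) t^m, component k being the coefficient of ε^k. Then θ + N acts
as θ does on t^(m+ε): the m-th term is multiplied by m + ε. -/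
theorem jordan_ofCoeff (c : ℕ → K⟦X⟧) :
    jordan K (ofCoeff c) = ofCoeff fun m => ((m : K⟦X⟧) + PowerSeries.X) * c m := by
  have hm : ∀ (m k : ℕ) (f : K⟦X⟧), PowerSeries.coeff k ((m : K⟦X⟧) * f) =
      m * PowerSeries.coeff k f := by
    intro m k f
    rw [← map_natCast PowerSeries.C, PowerSeries.coeff_C_mul]
  ext k m
  cases k with
  | zero => simp [jordan_zero, ofCoeff, add_mul]
  | succ k => simp [jordan_succ, ofCoeff, add_mul, hm, PowerSeries.coeff_succ_X_mul]

theorem jordan_pow_ofCoeff (c : ℕ → K⟦X⟧) (i : ℕ) :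
    (jordan K ^ i) (ofCoeff c) = ofCoeff fun m => ((m : K⟦X⟧) + PowerSeries.X) ^ i * c m := by
  induction i with
  | zero => simp
  | succ i ih =>
    rw [end_pow_succ_apply, ih, jordan_ofCoeff]
    simp only [pow_succ', mul_assoc]

theorem coeff_smul_ofCoeff (f : K⟦X⟧) (c : ℕ → K⟦X⟧) (k m : ℕ) :
    PowerSeries.coeff m ((f • ofCoeff c) k) = PowerSeries.coeff k
      (∑ l ∈ Finset.range (m + 1), PowerSeries.C (PowerSeries.coeff (m - l) f) * c l) := by
  rw [Pi.smul_apply, smul_eq_mul, mul_comm, PowerSeries.coeff_mul,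
    Finset.Nat.sum_antidiagonal_eq_sum_range_succ
      (fun p q => PowerSeries.coeff p (ofCoeff c k) * PowerSeries.coeff q f), map_sum]
  refine Finset.sum_congr rfl fun l _ => ?_
  rw [PowerSeries.coeff_C_mul, mul_comm, ofCoeff, PowerSeries.coeff_mk]

/-- The recursion for c_m(ε) makes 𝓛 send Σ c_m(ε) t^m to ε^n, which is invisible in the components
below n. The last clause holds because c_0 = 1 has no term in ε. -/
theorem exists_jordanSolution [CharZero K] {n : ℕ} {a : ℕ → RatFunc K} (h : NullExponents n a) :
    ∃ g, IsJordanSolution n a g ∧ PowerSeries.constantCoeff (g 1) = 0 := by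
  let A : ℕ → K⟦X⟧ := fun i => expansion (a i)
  refine ⟨ofCoeff (frobeniusCoeff n A), ⟨?_, ?_⟩, ?_⟩
  · simp [ofCoeff, frobeniusCoeff]
  · intro k hk
    ext m
    rw [connAct_operator, Pi.add_apply, Finset.sum_apply, map_add, map_sum, map_zero]
    simp only [jordan_pow_ofCoeff, coeff_smul_ofCoeff]
    rw [ofCoeff, PowerSeries.coeff_mk, ← map_sum, ← map_add]
    -- The term l = m carries the factor a_i(0) = 0, by condition (N); what remains is the
    -- recursion.
    simp only [Finset.sum_range_succ _ m]
    rw [Finset.sum_add_distrib, Finset.sum_eq_zero (s := Finset.range n)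
      (f := fun i => PowerSeries.C (PowerSeries.coeff (m - m) (expansion (a i))) *
        (((m : K⟦X⟧) + PowerSeries.X) ^ i * frobeniusCoeff n A m)), add_zero]
    · cases m with
      | zero => simp [frobeniusCoeff, PowerSeries.coeff_X_pow, hk.ne]
      | succ m => rw [Finset.sum_comm, frobeniusCoeff_rec n A m, map_zero]
    · intro i hi
      rw [Nat.sub_self, PowerSeries.coeff_zero_eq_constantCoeff_apply,
        constantCoeff_expansion_eq_zero h (Finset.mem_range.1 hi), map_zero, zero_mul]
  · simp [ofCoeff, frobeniusCoeff, PowerSeries.coeff_one]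

/-! ### The lattice -/

section LatticeBasics

variable {n : ℕ} {a : ℕ → RatFunc K}

theorem powerSeries_smul_lattice (f : K⟦X⟧) (x : Lattice n a) : f • x = mulOp K f • x := by
  obtain ⟨d, rfl⟩ := Submodule.Quotient.mk_surjective _ x
  rfl

/-- The action of `θ` on `Λ`. -/
def latticeTheta (n : ℕ) (a : ℕ → RatFunc K) : AddMonoid.End (Lattice n a) :=
  DistribSMul.toAddMonoidHom (Lattice n a) (thetaOp K)

theorem thetaOp_smul_smul (f : K⟦X⟧) (x : Lattice n a) :
    thetaOp K • f • x = f • thetaOp K • x + theta K f • x := by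
  simp only [powerSeries_smul_lattice, smul_smul, ← add_smul, thetaOp_mul_mulOp]

theorem eta_eq_mk (j : ℕ) : eta n a j = Submodule.Quotient.mk (thetaOp K ^ j) := by
  rw [eta, ← Submodule.Quotient.mk_smul, smul_eq_mul, mul_one]

theorem thetaOp_smul_eta (j : ℕ) : thetaOp K • eta n a j = eta n a (j + 1) := by
  rw [eta, smul_smul, ← pow_succ', eta]

theorem eta_order : eta n a n = -∑ i ∈ Finset.range n, expansion (a i) • eta n a i := by
  have h : (Submodule.Quotient.mk (operator n a) : Lattice n a) = 0 :=
    (Submodule.Quotient.mk_eq_zero _).2 (Submodule.mem_span_singleton_self _)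
  rw [operator, Submodule.Quotient.mk_add] at h
  refine eq_neg_of_add_eq_zero_left (Eq.trans ?_ h)
  rw [eta_eq_mk]
  congr 1
  rw [← Submodule.mkQ_apply, map_sum]
  refine Finset.sum_congr rfl fun i _ => ?_
  rw [eta_eq_mk]
  rfl

/-- The `K[[t]]`-span of `η^(j)`, `j < k`. -/
def etaSpan (n : ℕ) (a : ℕ → RatFunc K) (k : ℕ) : Submodule K⟦X⟧ (Lattice n a) :=
  Submodule.span K⟦X⟧ (Set.range fun j : Fin k => eta n a j)

theorem eta_mem_etaSpan {j k : ℕ} (h : j < k) : eta n a j ∈ etaSpan n a k :=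
  Submodule.subset_span ⟨⟨j, h⟩, rfl⟩

theorem mem_etaSpan {k : ℕ} {x : Lattice n a} :
    x ∈ etaSpan n a k ↔ ∃ c : ℕ → K⟦X⟧, x = ∑ j ∈ Finset.range k, c j • eta n a j := by
  rw [etaSpan, Submodule.mem_span_range_iff_exists_fun]
  constructor
  · rintro ⟨c, rfl⟩
    refine ⟨fun j => if h : j < k then c ⟨j, h⟩ else 0, ?_⟩
    rw [Finset.sum_range]
    simp
  · rintro ⟨c, rfl⟩
    exact ⟨fun j => c j, by rw [Finset.sum_range]⟩

theorem etaSpan_order : etaSpan n a n = ⊤ := by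
  rw [eq_top_iff]
  have hstep : ∀ x ∈ etaSpan n a n, thetaOp K • x ∈ etaSpan n a n := by
    intro x hx
    induction hx using Submodule.span_induction with
    | mem x hx =>
      obtain ⟨j, rfl⟩ := hx
      simp only [thetaOp_smul_eta]
      rcases Nat.lt_or_ge ((j : ℕ) + 1) n with h | h
      · exact eta_mem_etaSpan h
      · have h2 : (j : ℕ) + 1 = n := by omega
        rw [h2, eta_order]
        exact neg_mem (sum_mem fun i hi =>
          Submodule.smul_mem _ _ (eta_mem_etaSpan (Finset.mem_range.1 hi)))
    | zero => rw [smul_zero]; exact zero_mem _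
    | add x y _ _ hx hy => rw [smul_add]; exact add_mem hx hy
    | smul f x hx h =>
      rw [thetaOp_smul_smul]
      exact add_mem (Submodule.smul_mem _ _ h) (Submodule.smul_mem _ _ hx)
  have key : ∀ d : DiffOp K, ∀ x ∈ etaSpan n a n, d • x ∈ etaSpan n a n := by
    intro d
    induction d using diffOp_induction with
    | hmul f =>
      intro x hx
      rw [← powerSeries_smul_lattice]
      exact Submodule.smul_mem _ _ hx
    | htheta => exact hstep
    | hadd d e hd he => intro x hx; rw [add_smul]; exact add_mem (hd x hx) (he x hx)
    | hprod d e hd he => intro x hx; rw [mul_smul]; exact hd _ (he x hx)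
  have h0 : eta n a 0 ∈ etaSpan n a n := by
    rcases Nat.eq_zero_or_pos n with h | h
    · subst h
      rw [eta_order]
      simp
    · exact eta_mem_etaSpan h
  intro x _
  obtain ⟨d, rfl⟩ := Submodule.Quotient.mk_surjective _ x
  have := key d _ h0
  rwa [eta_eq_mk, ← Submodule.Quotient.mk_smul, pow_zero, smul_eq_mul, mul_one] at this

theorem etaSpan_mono {k l : ℕ} (h : k ≤ l) : etaSpan n a k ≤ etaSpan n a l := by
  refine Submodule.span_le.2 ?_
  rintro _ ⟨j, rfl⟩
  exact eta_mem_etaSpan (j.2.trans_le h)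

theorem fil_eq_etaSpan (i : ℤ) : Fil n a i = etaSpan n a (n - i).toNat := by
  rw [Fil, etaSpan]
  congr 1
  ext x
  constructor
  · rintro ⟨j, hj, rfl⟩
    exact ⟨⟨j, by omega⟩, rfl⟩
  · rintro ⟨j, rfl⟩
    exact ⟨j, by omega, rfl⟩

theorem isTrivial_of_equal {U V : Submodule (DiffOp K) (Lattice n a)} (h : V ≤ U) :
    IsTrivial (K := K) (↥V ⧸ U.submoduleOf V) := by
  refine ⟨0, ⟨?_⟩⟩
  have : Subsingleton (↥V ⧸ U.submoduleOf V) := by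
    rw [Submodule.Quotient.subsingleton_iff, Submodule.submoduleOf, Submodule.comap_subtype_eq_top]
    exact h
  exact LinearEquiv.ofSubsingleton _ _

variable [CharZero K] {M : Type*} [AddCommGroup M] [Module K⟦X⟧ M]

/-- The horizontal map `Λ → M` sending `η` to a given solution `m` of `𝓛` in `M`. -/
def latticeLift (n : ℕ) (a : ℕ → RatFunc K) (D : AddMonoid.End M) (hD : IsConnection (K := K) D)
    (m : M) (hm : connAct D (operator n a) m = 0) : Lattice n a →ₗ[K⟦X⟧] M :=
  (Submodule.liftQ ((Submodule.span (DiffOp K) {operator n a}).restrictScalars K⟦X⟧)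
    { toFun := fun d => connAct D d m
      map_add' := fun d e => connAct_add D d e m
      map_smul' := fun f d => connAct_smul D f d m }
    (by
      intro x hx
      obtain ⟨d, rfl⟩ := Submodule.mem_span_singleton.1 hx
      rw [LinearMap.mem_ker]
      change connAct D (d * operator n a) m = 0
      rw [connAct_mul hD, hm, map_zero])) ∘ₗ
  (Submodule.Quotient.restrictScalarsEquiv K⟦X⟧ _).symm.toLinearMap

variable {D : AddMonoid.End M} {hD : IsConnection (K := K) D} {m : M}
  {hm : connAct D (operator n a) m = 0}

theorem latticeLift_mk (d : DiffOp K) :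
    latticeLift n a D hD m hm (Submodule.Quotient.mk d) = connAct D d m := rfl

theorem latticeLift_thetaOp (x : Lattice n a) :
    latticeLift n a D hD m hm (thetaOp K • x) = D (latticeLift n a D hD m hm x) := by
  obtain ⟨d, rfl⟩ := Submodule.Quotient.mk_surjective _ x
  rw [← Submodule.Quotient.mk_smul, latticeLift_mk, latticeLift_mk, smul_eq_mul,
    connAct_thetaOp_mul hD]

theorem latticeLift_eta (j : ℕ) : latticeLift n a D hD m hm (eta n a j) = (D ^ j) m := by
  rw [eta_eq_mk, latticeLift_mk, connAct_pow]

end LatticeBasics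

/-! ### The flat coordinates of the lattice -/

section FlatCoordinates

variable {n : ℕ} {a : ℕ → RatFunc K} {g : ℕ → K⟦X⟧}

/-- Truncation of a sequence of power series. -/
def truncSeq (n : ℕ) (y : ℕ → K⟦X⟧) : ℕ → K⟦X⟧ := fun k => if k < n then y k else 0

/-- The Jordan connection with truncated nilpotent part. -/
def jordanTrunc (K : Type*) [Field K] (n : ℕ) : AddMonoid.End (ℕ → K⟦X⟧) where
  toFun y k := if k < n then jordan K y k else theta K (y k)
  map_zero' := by ext1 k; simp
  map_add' y z := by ext1 k; simp only [map_add, Pi.add_apply]; split_ifs <;> rfl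

theorem jordanTrunc_apply (y : ℕ → K⟦X⟧) (k : ℕ) :
    jordanTrunc K n y k = if k < n then jordan K y k else theta K (y k) := rfl

theorem isConnection_jordanTrunc : IsConnection (K := K) (jordanTrunc K n) := by
  intro f y
  ext1 k
  rw [Pi.add_apply, Pi.smul_apply, jordanTrunc_apply, jordanTrunc_apply]
  split_ifs
  · rw [isConnection_jordan]; rfl
  · simp only [Pi.smul_apply, Derivation.leibniz, smul_eq_mul]; ring

theorem jordanTrunc_truncSeq (y : ℕ → K⟦X⟧) :
    jordanTrunc K n (truncSeq n y) = truncSeq n (jordan K y) := by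
  ext1 k
  rw [jordanTrunc_apply, truncSeq]
  split_ifs with h
  · cases k with
    | zero => simp [jordan_zero, truncSeq, h]
    | succ k => simp [jordan_succ, truncSeq, h, Nat.lt_of_succ_lt h]
  · simp [truncSeq, h]

theorem jordanTrunc_pow_truncSeq (y : ℕ → K⟦X⟧) (s : ℕ) :
    (jordanTrunc K n ^ s) (truncSeq n y) = truncSeq n ((jordan K ^ s) y) := by
  induction s with
  | zero => rfl
  | succ s ih => rw [end_pow_succ_apply, ih, jordanTrunc_truncSeq, end_pow_succ_apply]

variable [CharZero K]

/-- Only the components of g below n satisfy the equation; truncating both g and N gives a genuine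
solution, to which the lift from Λ applies. -/
theorem IsJordanSolution.connAct_jordanTrunc (hg : IsJordanSolution n a g) :
    connAct (jordanTrunc K n) (operator n a) (truncSeq n g) = 0 := by
  ext1 k
  rw [connAct_operator, Pi.add_apply, Finset.sum_apply]
  simp only [jordanTrunc_pow_truncSeq, Pi.smul_apply, truncSeq]
  split_ifs with h
  · have := hg.solution k h
    rwa [connAct_operator, Pi.add_apply, Finset.sum_apply] at this
  · simp

/-- The flat coordinates on `Λ` given by a solution. -/
def flatCoord (hg : IsJordanSolution n a g) : Lattice n a →ₗ[K⟦X⟧] (ℕ → K⟦X⟧) :=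
  latticeLift n a (jordanTrunc K n) isConnection_jordanTrunc (truncSeq n g) hg.connAct_jordanTrunc

theorem flatCoord_thetaOp_zero (hg : IsJordanSolution n a g) (x : Lattice n a) :
    flatCoord hg (thetaOp K • x) 0 = theta K (flatCoord hg x 0) := by
  rw [flatCoord, latticeLift_thetaOp, jordanTrunc_apply, jordan_zero, ite_self]

theorem flatCoord_thetaOp_succ (hg : IsJordanSolution n a g) (x : Lattice n a) {k : ℕ}
    (hk : k + 1 < n) :
    flatCoord hg (thetaOp K • x) (k + 1) = theta K (flatCoord hg x (k + 1)) + flatCoord hg x k := by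
  rw [flatCoord, latticeLift_thetaOp, jordanTrunc_apply, if_pos hk, jordan_succ]

theorem flatCoord_eta (hg : IsJordanSolution n a g) (j : ℕ) {k : ℕ} (hk : k < n) :
    flatCoord hg (eta n a j) k = (jordan K ^ j) g k := by
  rw [flatCoord, latticeLift_eta, jordanTrunc_pow_truncSeq, truncSeq, if_pos hk]

theorem flatCoord_sum (hg : IsJordanSolution n a g) {k : ℕ} (hk : k ≤ n) (c : ℕ → K⟦X⟧)
    (r : Fin k) :
    flatCoord hg (∑ j ∈ Finset.range k, c j • eta n a j) r =
      (jordanMatrix g k).mulVec (fun j => c j) r := by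
  rw [map_sum, Finset.sum_apply, Finset.sum_range]
  simp only [map_smul, Pi.smul_apply, flatCoord_eta hg _ (r.2.trans_le hk), smul_eq_mul]
  exact Finset.sum_congr rfl fun j _ => mul_comm _ _

theorem flatCoord_injOn (hg : IsJordanSolution n a g) {k : ℕ} (hk : k ≤ n) {c : ℕ → K⟦X⟧}
    (h : ∀ r < k, flatCoord hg (∑ j ∈ Finset.range k, c j • eta n a j) r = 0) :
    ∀ j < k, c j = 0 := by
  have h1 : (jordanMatrix g k).mulVec (fun j => c j) = (jordanMatrix g k).mulVec 0 := by
    rw [Matrix.mulVec_zero]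
    ext1 r
    rw [← flatCoord_sum hg hk, h r r.2]; rfl
  have h2 := Matrix.mulVec_injective_of_isUnit
    ((Matrix.isUnit_iff_isUnit_det _).2 (isUnit_det_jordanMatrix hg.constantCoeff k)) h1
  intro j hj
  exact congrFun h2 ⟨j, hj⟩

theorem exists_flatCoord_eq (hg : IsJordanSolution n a g) {k : ℕ} (hk : k ≤ n) (y : ℕ → K⟦X⟧) :
    ∃ x ∈ etaSpan n a k, ∀ j < k, flatCoord hg x j = y j := by
  let c : Fin k → K⟦X⟧ := (jordanMatrix g k)⁻¹.mulVec fun j => y j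
  let c' : ℕ → K⟦X⟧ := fun j => if h : j < k then c ⟨j, h⟩ else 0
  have hc : (fun j : Fin k => c' j) = c := by ext1 j; simp [c']
  refine ⟨_, mem_etaSpan.2 ⟨c', rfl⟩, fun j hj => ?_⟩
  have := flatCoord_sum hg hk c' ⟨j, hj⟩
  rw [hc, Matrix.mulVec_mulVec,
    Matrix.mul_nonsing_inv _ (isUnit_det_jordanMatrix hg.constantCoeff k), Matrix.one_mulVec] at this
  exact this

/-- The submodule of `Λ` where the first `k` flat coordinates vanish. -/
def flatSub (hg : IsJordanSolution n a g) (k : ℕ) : Submodule (DiffOp K) (Lattice n a) where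
  carrier := {x | ∀ j < k, j < n → flatCoord hg x j = 0}
  zero_mem' := fun j _ _ => by rw [map_zero]; rfl
  add_mem' := fun {x y} hx hy j h1 h2 => by
    rw [map_add, Pi.add_apply, hx j h1 h2, hy j h1 h2, add_zero]
  smul_mem' := fun d => by
    induction d using diffOp_induction with
    | hmul f =>
      intro x hx j h1 h2
      rw [← powerSeries_smul_lattice, map_smul, Pi.smul_apply, hx j h1 h2, smul_zero]
    | htheta =>
      intro x hx j h1 h2
      cases j with
      | zero => rw [flatCoord_thetaOp_zero, hx 0 h1 h2, map_zero]
      | succ j =>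
        rw [flatCoord_thetaOp_succ hg x h2, hx _ h1 h2, hx j (by omega) (by omega), map_zero,
          add_zero]
    | hadd d e hd he =>
      intro x hx j h1 h2
      rw [add_smul, map_add, Pi.add_apply, hd hx j h1 h2, he hx j h1 h2, add_zero]
    | hprod d e hd he =>
      intro x hx
      rw [mul_smul]
      exact hd (he hx)

theorem flatSub_anti (hg : IsJordanSolution n a g) : Antitone (flatSub hg) :=
  fun _ _ h _ hx j h1 h2 => hx j (h1.trans_le h) h2

theorem isCompl_flatSub_of_le (hg : IsJordanSolution n a g) {k : ℕ} (hk : k ≤ n) :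
    IsCompl ((flatSub hg k).restrictScalars K⟦X⟧) (etaSpan n a k) := by
  constructor
  · rw [Submodule.disjoint_def]
    intro x hx hx'
    obtain ⟨c, rfl⟩ := mem_etaSpan.1 hx'
    have := flatCoord_injOn hg hk (c := c) fun r hr => hx r hr (hr.trans_le hk)
    exact Finset.sum_eq_zero fun j hj => by rw [this j (Finset.mem_range.1 hj), zero_smul]
  · rw [codisjoint_iff, eq_top_iff]
    intro x _
    obtain ⟨z, hz, hzx⟩ := exists_flatCoord_eq hg hk (flatCoord hg x)
    rw [← sub_add_cancel x z]
    refine Submodule.add_mem_sup (fun j h1 _ => ?_) hz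
    rw [map_sub, Pi.sub_apply, hzx j h1, sub_self]

theorem isCompl_flatSub (hg : IsJordanSolution n a g) (k : ℕ) :
    IsCompl ((flatSub hg k).restrictScalars K⟦X⟧) (etaSpan n a k) := by
  rcases le_total k n with h | h
  · exact isCompl_flatSub_of_le hg h
  · have h1 : etaSpan n a k = etaSpan n a n := by
      rw [etaSpan_order, eq_top_iff, ← etaSpan_order]; exact etaSpan_mono h
    have h2 : flatSub hg k = flatSub hg n := le_antisymm (flatSub_anti hg h)
      fun x hx j _ hj => hx j hj hj
    rw [h1, h2]
    exact isCompl_flatSub_of_le hg le_rfl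

theorem eq_zero_of_flatCoord (hg : IsJordanSolution n a g) {x : Lattice n a}
    (h : ∀ j < n, flatCoord hg x j = 0) : x = 0 := by
  have h1 := (isCompl_flatSub_of_le hg le_rfl).disjoint
  rw [etaSpan_order, disjoint_top] at h1
  have : x ∈ (flatSub hg n).restrictScalars K⟦X⟧ := fun j hj _ => h j hj
  rwa [h1, Submodule.mem_bot] at this

/-- If θ y_0 = 0 and θ y_{j+1} + y_j = 0, then y_0 is constant, and its constant term vanishes
because that of θ y_1 does; continue upwards. The last coordinate has no successor equation, which
costs one index. -/
theorem mem_flatSub_of_thetaOp (hg : IsJordanSolution n a g) {k : ℕ} (hk : k ≤ n) {x : Lattice n a}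
    (hx : thetaOp K • x ∈ flatSub hg k) : x ∈ flatSub hg (k - 1) := by
  have hstep : ∀ j, j + 1 < k → theta K (flatCoord hg x j) = 0 → flatCoord hg x j = 0 := by
    intro j hj h
    have h1 := hx (j + 1) hj (by omega)
    rw [flatCoord_thetaOp_succ hg x (by omega)] at h1
    have h2 := congrArg PowerSeries.constantCoeff h1
    rw [map_add, constantCoeff_theta, zero_add, map_zero] at h2
    rw [theta_eq_zero h, h2, map_zero]
  have key : ∀ j, j + 1 < k → flatCoord hg x j = 0 := by
    intro j
    induction j with
    | zero =>
      intro hj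
      refine hstep 0 hj ?_
      rw [← flatCoord_thetaOp_zero]
      exact hx 0 (by omega) (by omega)
    | succ j ih =>
      intro hj
      refine hstep _ hj ?_
      have h1 := hx (j + 1) (by omega) (by omega)
      rwa [flatCoord_thetaOp_succ hg x (by omega), ih (by omega), add_zero] at h1
  intro j hj _
  exact key j (by omega)

/-! ### The opposite filtration -/

/-- Coordinate k is horizontal on this submodule because coordinate k-1 vanishes there; it
identifies the quotient with K[[t]]. -/
theorem isTrivial_flatSub (hg : IsJordanSolution n a g) {k : ℕ} (hk : k < n) :
    IsTrivial (K := K) (↥(flatSub hg k) ⧸ (flatSub hg (k + 1)).submoduleOf (flatSub hg k)) := by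
  let φ₀ : ↥(flatSub hg k) →+ K⟦X⟧ :=
    { toFun := fun x => flatCoord hg (x : Lattice n a) k
      map_zero' := by simp
      map_add' := fun x y => by simp }
  let φ : ↥(flatSub hg k) →ₗ[DiffOp K] K⟦X⟧ := diffOpLinear φ₀
    (fun f x => by
      change flatCoord hg (mulOp K f • (x : Lattice n a)) k = f * flatCoord hg (x : Lattice n a) k
      rw [← powerSeries_smul_lattice, map_smul]; rfl)
    (fun x => by
      change flatCoord hg (thetaOp K • (x : Lattice n a)) k =
        theta K (flatCoord hg (x : Lattice n a) k)
      cases k with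
      | zero => rw [flatCoord_thetaOp_zero]
      | succ k =>
        rw [flatCoord_thetaOp_succ hg _ hk, x.2 k (by omega) (by omega), add_zero])
  have hφ : ∀ x, φ x = flatCoord hg (x : Lattice n a) k := fun x => rfl
  have hsurj : Function.Surjective φ := by
    intro f
    obtain ⟨x, _, hx⟩ := exists_flatCoord_eq hg (k := k + 1) hk fun j => if j = k then f else 0
    refine ⟨⟨x, fun j hj _ => ?_⟩, ?_⟩
    · rw [hx j (by omega), if_neg hj.ne]
    · rw [hφ, hx k (by omega), if_pos rfl]
  have hker : (flatSub hg (k + 1)).submoduleOf (flatSub hg k) = LinearMap.ker φ := by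
    ext x
    rw [LinearMap.mem_ker, hφ]
    change (x : Lattice n a) ∈ flatSub hg (k + 1) ↔ _
    constructor
    · intro h; exact h k (by omega) hk
    · intro h j hj hjn
      rcases Nat.lt_or_ge j k with h' | h'
      · exact x.2 j h' hjn
      · rw [show j = k by omega, h]
  exact ⟨1, ⟨(Submodule.quotEquivOfEq _ _ hker).trans ((φ.quotKerEquivOfSurjective hsurj).trans
    (LinearEquiv.funUnique (Fin 1) (DiffOp K) K⟦X⟧).symm)⟩⟩

theorem isOppositeFiltration_flatSub (hg : IsJordanSolution n a g) :
    IsOppositeFiltration n a fun i => flatSub hg (n - 1 - i).toNat := by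
  refine ⟨fun i j h => flatSub_anti hg (by omega), fun i => ?_, fun i => ?_⟩
  · rw [fil_eq_etaSpan, show (n : ℤ) - (i + 1) = n - 1 - i by ring]
    exact isCompl_flatSub hg _
  -- Outside this range both indices define the same submodule: either `toNat` gives 0 twice, or
  -- both are at least n, where no further coordinates are tested.
  · by_cases h : 0 ≤ (n : ℤ) - 1 - (i + 1) ∧ (n : ℤ) - 1 - (i + 1) < n
    · obtain ⟨k, hk⟩ := Int.eq_ofNat_of_zero_le h.1
      have h1 : ((n : ℤ) - 1 - (i + 1)).toNat = k := by omega
      have h2 : ((n : ℤ) - 1 - i).toNat = k + 1 := by omega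
      rw [h1, h2]
      exact isTrivial_flatSub hg (by omega)
    · apply isTrivial_of_equal
      intro x hx j hj hjn
      exact hx j (by omega) hjn

theorem eq_of_le_of_isCompl {α : Type*} [_root_.Lattice α] [BoundedOrder α] [IsModularLattice α]
    {x y z : α} (hxy : x ≤ y) (hx : IsCompl x z) (hy : IsCompl y z) : x = y :=
  eq_of_le_of_inf_le_of_sup_le hxy (hy.inf_eq_bot.le.trans bot_le)
    (le_top.trans hx.sup_eq_top.ge)

/-- Both submodules complement the same step of `Fil`, so by modularity one inclusion suffices. It
is proved upwards from U_{-1} = 0. -/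
theorem IsOppositeFiltration.eq_flatSub (hg : IsJordanSolution n a g)
    {U : ℤ → Submodule (DiffOp K) (Lattice n a)} (hU : IsOppositeFiltration n a U) (i : ℤ) :
    U i = flatSub hg (n - 1 - i).toNat := by
  have hV := isOppositeFiltration_flatSub hg
  suffices h : U i ≤ flatSub hg (n - 1 - i).toNat from
    Submodule.restrictScalars_injective K⟦X⟧ _ _
      (eq_of_le_of_isCompl h (hU.opposite i) (hV.opposite i))
  have hneg : ∀ i : ℤ, i ≤ -1 → U i = ⊥ := by
    intro i hi
    have h1 := (hU.opposite i).disjoint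
    have h2 : Fil n a (i + 1) = ⊤ := by
      rw [fil_eq_etaSpan, eq_top_iff, ← etaSpan_order]
      exact etaSpan_mono (by omega)
    rw [h2, disjoint_top, Submodule.restrictScalars_eq_bot_iff] at h1
    exact h1
  rcases le_total i (-1) with hi | hi
  · rw [hneg i hi]; exact bot_le
  · induction i, hi using Int.leInduction with
    | base => rw [hneg _ le_rfl]; exact bot_le
    | succ i hi ih =>
      obtain ⟨m, ⟨e⟩⟩ := hU.trivial i
      have hk : ((n : ℤ) - 1 - (i + 1)).toNat = ((n : ℤ) - 1 - i).toNat - 1 := by omega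
      have hle : U i ≤ flatSub hg ((n : ℤ) - 1 - (i + 1)).toNat :=
        ih.trans (flatSub_anti hg (by omega))
      -- Lifts b of a horizontal basis of the graded piece satisfy θ b ∈ U_i, which by induction has
      -- many vanishing coordinates; so b has at most one fewer guaranteed.
      have hb : ∀ j : Fin m, ∃ b ∈ flatSub hg ((n : ℤ) - 1 - (i + 1)).toNat, ∃ hb : b ∈ U (i + 1),
          e (Submodule.Quotient.mk ⟨b, hb⟩) = Pi.single j 1 := by
        intro j
        obtain ⟨b, hb⟩ := Submodule.Quotient.mk_surjective _ (e.symm (Pi.single j 1))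
        refine ⟨b, ?_, b.2, ?_⟩
        · rw [hk]
          refine mem_flatSub_of_thetaOp hg (by omega) (ih ?_)
          have h1 : e (Submodule.Quotient.mk (thetaOp K • b)) = 0 := by
            rw [Submodule.Quotient.mk_smul, map_smul, hb, e.apply_symm_apply]
            ext1 l
            rw [Pi.smul_apply, thetaOp_smul, Pi.single_apply]
            split_ifs
            · rw [Derivation.map_one_eq_zero]; rfl
            · rw [map_zero]; rfl
          rw [e.map_eq_zero_iff, Submodule.Quotient.mk_eq_zero] at h1
          exact h1
        · exact (congrArg e hb).trans (e.apply_symm_apply _)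
      choose b hbV hbU hbe using hb
      intro x hx
      let c := e (Submodule.Quotient.mk ⟨x, hx⟩)
      have h1 : e (Submodule.Quotient.mk (⟨x, hx⟩ - ∑ j, mulOp K (c j) • ⟨b j, hbU j⟩)) = 0 := by
        rw [← Submodule.mkQ_apply, map_sub, map_sum, map_sub, map_sum, sub_eq_zero]
        simp only [map_smul, Submodule.mkQ_apply, hbe]
        ext1 l
        rw [Finset.sum_apply]
        simp only [Pi.smul_apply, mulOp_smul, Pi.single_apply, mul_ite, mul_one, mul_zero]
        rw [Finset.sum_ite_eq]
        simp [c]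
      rw [e.map_eq_zero_iff, Submodule.Quotient.mk_eq_zero] at h1
      have h2 := hle h1
      have h3 : x = ((⟨x, hx⟩ - ∑ j, mulOp K (c j) • ⟨b j, hbU j⟩ : ↥(U (i + 1))) : Lattice n a) +
          ∑ j, mulOp K (c j) • b j := by
        simp
      rw [h3]
      exact add_mem h2 (sum_mem fun j _ => Submodule.smul_mem _ _ (hbV j))

end FlatCoordinates

/-! ### The exponential and the factor `β` -/

section Exponential

theorem hasSubst_of_constantCoeff {f : K⟦X⟧} (hf : PowerSeries.constantCoeff f = 0) :
    PowerSeries.HasSubst f := PowerSeries.HasSubst.of_constantCoeff_zero' hf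

theorem constantCoeff_logIntegral (f : K⟦X⟧) :
    PowerSeries.constantCoeff (logIntegral f) = 0 := by
  rw [← PowerSeries.coeff_zero_eq_constantCoeff_apply, logIntegral, PowerSeries.coeff_mk]
  simp

variable [CharZero K]

theorem constantCoeff_expSeries {f : K⟦X⟧} (hf : PowerSeries.constantCoeff f = 0) :
    PowerSeries.constantCoeff (expSeries f) = 1 := by
  rw [expSeries, ← PowerSeries.coeff_zero_eq_constantCoeff_apply,
    PowerSeries.coeff_subst' (hasSubst_of_constantCoeff hf), finsum_eq_single _ 0]
  · simp
  · intro d hd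
    simp [hf, hd]

theorem theta_expSeries {f : K⟦X⟧} (hf : PowerSeries.constantCoeff f = 0) :
    theta K (expSeries f) = theta K f * expSeries f := by
  rw [theta_apply, theta_apply, expSeries,
    PowerSeries.derivative_subst (hasSubst_of_constantCoeff hf), PowerSeries.derivative_exp]
  ring

theorem constantCoeff_betaFactor (n : ℕ) (a : ℕ → RatFunc K) :
    PowerSeries.constantCoeff (betaFactor n a) = 1 := by
  apply constantCoeff_expSeries
  rw [map_mul, constantCoeff_logIntegral, mul_zero]

end Exponential

/-! ### The dual of the lattice -/

section Duality

/-- The connection on the dual of a module with connection. -/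
def dualConnection {M : Type*} [AddCommGroup M] [Module K⟦X⟧ M] {D : AddMonoid.End M}
    (hD : IsConnection (K := K) D) : AddMonoid.End (M →ₗ[K⟦X⟧] K⟦X⟧) where
  toFun φ :=
    { toFun := fun x => theta K (φ x) - φ (D x)
      map_add' := fun x y => by simp only [map_add]; ring
      map_smul' := fun f x => by
        rw [hD]
        simp only [map_smul, map_add, smul_eq_mul, Derivation.leibniz, RingHom.id_apply]
        ring }
  map_zero' := by ext x; simp
  map_add' φ ψ := by
    ext1 x
    simp only [LinearMap.add_apply, LinearMap.coe_mk, AddHom.coe_mk, map_add]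
    ring

theorem dualConnection_apply {M : Type*} [AddCommGroup M] [Module K⟦X⟧ M] {D : AddMonoid.End M}
    (hD : IsConnection (K := K) D) (φ : M →ₗ[K⟦X⟧] K⟦X⟧) (x : M) :
    dualConnection hD φ x = theta K (φ x) - φ (D x) := rfl

theorem isConnection_dualConnection {M : Type*} [AddCommGroup M] [Module K⟦X⟧ M]
    {D : AddMonoid.End M} (hD : IsConnection (K := K) D) :
    IsConnection (K := K) (dualConnection hD) := by
  intro f φ
  ext1 x
  simp only [dualConnection_apply, LinearMap.smul_apply, LinearMap.add_apply, smul_eq_mul,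
    Derivation.leibniz]
  ring

variable {n : ℕ} {a : ℕ → RatFunc K} {g : ℕ → K⟦X⟧}

theorem isConnection_latticeTheta : IsConnection (K := K) (latticeTheta n a) :=
  fun f x => thetaOp_smul_smul f x

/-- The connection on the dual of `Λ`. -/
def dualTheta (n : ℕ) (a : ℕ → RatFunc K) : AddMonoid.End (Lattice n a →ₗ[K⟦X⟧] K⟦X⟧) :=
  dualConnection isConnection_latticeTheta

theorem dualTheta_apply (φ : Lattice n a →ₗ[K⟦X⟧] K⟦X⟧) (x : Lattice n a) :
    dualTheta n a φ x = theta K (φ x) - φ (thetaOp K • x) := rfl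

theorem isConnection_dualTheta : IsConnection (K := K) (dualTheta n a) :=
  isConnection_dualConnection _

/-- Cramer's rule: the corner cofactor is the determinant of the truncated matrix, with sign
(-1)^(2k) = 1. -/
theorem det_jordanMatrix_mul_of_mulVec {g : ℕ → K⟦X⟧} {k : ℕ} {v : Fin (k + 1) → K⟦X⟧} {p : K⟦X⟧}
    (h : (jordanMatrix g (k + 1)).mulVec v = Pi.single (Fin.last k) p) :
    (jordanMatrix g (k + 1)).det * v (Fin.last k) = (jordanMatrix g k).det * p := by
  have h1 := congrArg (jordanMatrix g (k + 1)).adjugate.mulVec h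
  rw [Matrix.mulVec_mulVec, Matrix.adjugate_mul, Matrix.smul_mulVec, Matrix.one_mulVec] at h1
  have h2 := congrFun h1 (Fin.last k)
  rw [Pi.smul_apply, smul_eq_mul, Matrix.mulVec_single, Pi.smul_apply,
    Matrix.col_apply, Matrix.adjugate_fin_succ_eq_det_submatrix] at h2
  rw [h2, Fin.succAbove_last, ← two_mul, pow_mul, neg_one_sq, one_pow, one_mul]
  rfl

variable [CharZero K]

/-- The `η^(j)` form a basis of `Λ`. -/
def etaBasis (hg : IsJordanSolution n a g) : Module.Basis (Fin n) K⟦X⟧ (Lattice n a) :=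
  Module.Basis.mk (v := fun j : Fin n => eta n a j)
    (by
      rw [Fintype.linearIndependent_iff]
      intro c hc j
      let c' : ℕ → K⟦X⟧ := fun j => if h : j < n then c ⟨j, h⟩ else 0
      have hc' : ∀ j : Fin n, c' j = c j := fun j => by simp [c']
      have h1 : ∑ j ∈ Finset.range n, c' j • eta n a j = 0 := by
        rw [Finset.sum_range, ← hc]
        simp only [hc']
      rw [← hc']
      exact flatCoord_injOn hg le_rfl (c := c') (fun r _ => by rw [h1, map_zero]; rfl) j j.2)
    (etaSpan_order (n := n) (a := a)).ge

theorem etaBasis_apply (hg : IsJordanSolution n a g) (j : Fin n) :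
    etaBasis hg j = eta n a j := Module.Basis.mk_apply _ _ j

/-- The coordinate functions of the basis `η^(j)`. -/
def etaCoord (hg : IsJordanSolution n a g) (j : ℕ) : Lattice n a →ₗ[K⟦X⟧] K⟦X⟧ :=
  if h : j < n then (etaBasis hg).coord ⟨j, h⟩ else 0

theorem etaCoord_eta (hg : IsJordanSolution n a g) (j : ℕ) {k : ℕ} (hk : k < n) :
    etaCoord hg j (eta n a k) = if j = k then 1 else 0 := by
  have h1 : eta n a k = etaBasis hg ⟨k, hk⟩ := (etaBasis_apply hg ⟨k, hk⟩).symm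
  rw [h1, etaCoord]
  split_ifs with h2 h3 h3
  · subst h3
    rw [Module.Basis.coord_apply, Module.Basis.repr_self, Finsupp.single_eq_same]
  · rw [Module.Basis.coord_apply, Module.Basis.repr_self, Finsupp.single_apply, if_neg]
    intro h
    exact h3 (congrArg Fin.val h).symm
  · omega
  · rfl

theorem dual_ext (hg : IsJordanSolution n a g) {φ ψ : Lattice n a →ₗ[K⟦X⟧] K⟦X⟧}
    (h : ∀ k < n, φ (eta n a k) = ψ (eta n a k)) : φ = ψ := by
  apply (etaBasis hg).ext
  intro i
  rw [etaBasis_apply]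
  exact h i i.2

/-- This is the transpose of the companion matrix of θ in the basis η^(j). -/
theorem neg_dualTheta_etaCoord (hg : IsJordanSolution n a g) {j : ℕ} (hj : j < n) :
    (-dualTheta n a) (etaCoord hg j) + expansion (a j) • etaCoord hg (n - 1) =
      if j = 0 then 0 else etaCoord hg (j - 1) := by
  apply dual_ext hg
  intro k hk
  have h1 : (-dualTheta n a) (etaCoord hg j) = -(dualTheta n a (etaCoord hg j)) := rfl
  have h0 : theta K (etaCoord hg j (eta n a k)) = 0 := by
    rw [etaCoord_eta hg j hk]
    split_ifs
    · exact Derivation.map_one_eq_zero _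
    · exact map_zero _
  rw [h1, LinearMap.add_apply, LinearMap.neg_apply, dualTheta_apply, h0, thetaOp_smul_eta,
    LinearMap.smul_apply, etaCoord_eta hg _ hk]
  have h2 : (if j = 0 then 0 else etaCoord hg (j - 1)) (eta n a k) =
      if j = k + 1 then (1 : K⟦X⟧) else 0 := by
    by_cases hj0 : j = 0
    · rw [if_pos hj0, if_neg (by omega)]; rfl
    · rw [if_neg hj0, etaCoord_eta hg _ hk]
      exact if_congr (by omega) rfl rfl
  rw [h2]
  rcases Nat.lt_or_ge (k + 1) n with h | h
  · rw [etaCoord_eta hg j h, if_neg (show ¬ n - 1 = k by omega)]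
    simp
  · have hkn : k + 1 = n := by omega
    rw [if_pos (show n - 1 = k by omega), hkn, eta_order, map_neg, map_sum, if_neg (by omega)]
    simp only [map_smul]
    rw [Finset.sum_eq_single j]
    · rw [etaCoord_eta hg j hj]; simp
    · intro i hi hij
      rw [etaCoord_eta hg j (Finset.mem_range.1 hi), if_neg (Ne.symm hij), smul_zero]
    · intro h; exact absurd (Finset.mem_range.2 hj) h

/-- Iterating the preceding relation downwards from index n-1 is a Horner scheme; at s = n its left
side is the formal adjoint applied to the last coordinate function. -/
theorem horner_etaCoord (hg : IsJordanSolution n a g) (s : ℕ) (hs : s ≤ n) :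
    ((-dualTheta n a) ^ s) (etaCoord hg (n - 1)) +
      ∑ i ∈ Finset.range s, ((-dualTheta n a) ^ i)
        (expansion (a (n - s + i)) • etaCoord hg (n - 1)) =
      if s = n then 0 else etaCoord hg (n - 1 - s) := by
  induction s with
  | zero =>
    rw [Finset.sum_range_zero, add_zero]
    split_ifs with h
    · subst h
      simp [etaCoord]
    · rfl
  | succ s ih =>
    have h := neg_dualTheta_etaCoord hg (j := n - 1 - s) (by omega)
    have ih' := ih (by omega)
    rw [if_neg (by omega)] at ih'
    rw [← ih', map_add, map_sum] at h
    rw [Finset.sum_range_succ', end_pow_succ_apply]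
    simp only [end_pow_succ_apply]
    have h2 : ∀ i, n - (s + 1) + (i + 1) = n - s + i := fun i => by omega
    simp only [h2]
    rw [← add_assoc, add_zero, show n - (s + 1) = n - 1 - s by omega]
    refine h.trans ?_
    by_cases h3 : s + 1 = n
    · rw [if_pos h3, if_pos (by omega)]
    · rw [if_neg h3, if_neg (by omega), show n - 1 - (s + 1) = n - 1 - s - 1 by omega]

theorem connAct_neg_one_pow_mul {M : Type*} [AddCommGroup M] [Module K⟦X⟧ M] (D : AddMonoid.End M)
    (i : ℕ) (d : DiffOp K) : connAct D ((-1) ^ i * d) = (-1) ^ i * connAct D d := by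
  rcases neg_one_pow_eq_or (DiffOp K) i with h | h <;>
    rcases Nat.even_or_odd i with hi | hi
  · rw [hi.neg_one_pow, hi.neg_one_pow, one_mul, one_mul]
  · rw [hi.neg_one_pow, hi.neg_one_pow, neg_one_mul, neg_one_mul, map_neg]
  · rw [hi.neg_one_pow, hi.neg_one_pow, one_mul, one_mul]
  · rw [hi.neg_one_pow, hi.neg_one_pow, neg_one_mul, neg_one_mul, map_neg]

theorem connAct_neg_one_pow_mul_pow {M : Type*} [AddCommGroup M] [Module K⟦X⟧ M]
    {D : AddMonoid.End M} (hD : IsConnection (K := K) D) (i : ℕ) (d : DiffOp K) (m : M) :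
    connAct D ((-1) ^ i * (thetaOp K ^ i * d)) m = ((-D) ^ i) (connAct D d m) := by
  rw [connAct_neg_one_pow_mul, neg_pow D]
  change ((-1) ^ i : AddMonoid.End _) (connAct D (thetaOp K ^ i * d) m) =
    ((-1) ^ i : AddMonoid.End _) ((D ^ i) _)
  rw [connAct_mul hD, connAct_pow]

theorem connAct_formalAdjoint (hg : IsJordanSolution n a g) :
    connAct (dualTheta n a) (formalAdjoint n a) (etaCoord hg (n - 1)) = 0 := by
  have h := horner_etaCoord hg n le_rfl
  rw [if_pos rfl] at h
  rw [formalAdjoint, connAct_add, connAct_sum, ← h]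
  congr 1
  · have := connAct_neg_one_pow_mul_pow (isConnection_dualTheta (n := n) (a := a)) n 1
      (etaCoord hg (n - 1))
    rwa [mul_one, connAct_one] at this
  · refine Finset.sum_congr rfl fun i _ => ?_
    rw [connAct_neg_one_pow_mul_pow (isConnection_dualTheta (n := n) (a := a)), connAct_mulOp, Nat.sub_self, zero_add]

/-- The only direct use of self-adjointness: the adjoint kills the last coordinate function, and
conjugation by β carries this over to 𝓛. -/
theorem connAct_operator_dual (hL : IsCalabiYau n a) (hg : IsJordanSolution n a g) :
    connAct (dualTheta n a) (operator n a) ((betaFactor n a)⁻¹ • etaCoord hg (n - 1)) = 0 := by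
  have h := connAct_formalAdjoint hg
  have hβ : (betaFactor n a)⁻¹ * betaFactor n a = 1 :=
    PowerSeries.inv_mul_cancel _ (by rw [constantCoeff_betaFactor]; exact one_ne_zero)
  rw [hL.selfAdjoint] at h
  have h2 : connAct (dualTheta n a)
      (mulOp K (betaFactor n a) * operator n a * mulOp K (betaFactor n a)⁻¹)
      (etaCoord hg (n - 1)) = 0 := by
    rw [connAct_neg_one_pow_mul] at h
    rcases Nat.even_or_odd n with hi | hi
    · rwa [hi.neg_one_pow, one_mul] at h
    · rw [hi.neg_one_pow, neg_one_mul] at h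
      exact neg_eq_zero.1 h
  rw [mul_assoc, connAct_mul (isConnection_dualTheta (n := n) (a := a)), connAct_mul (isConnection_dualTheta (n := n) (a := a)),
    connAct_mulOp, connAct_mulOp] at h2
  have h3 := congrArg (fun φ => (betaFactor n a)⁻¹ • φ) h2
  simpa only [smul_smul, hβ, one_smul, smul_zero] using h3

/-- The horizontal pairing on `Λ`. -/
def pairing (hL : IsCalabiYau n a) (hg : IsJordanSolution n a g) :
    Lattice n a →ₗ[K⟦X⟧] Lattice n a →ₗ[K⟦X⟧] K⟦X⟧ :=
  latticeLift n a (dualTheta n a) isConnection_dualTheta _ (connAct_operator_dual hL hg)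

theorem pairing_horizontal (hL : IsCalabiYau n a) (hg : IsJordanSolution n a g)
    (x y : Lattice n a) :
    theta K (pairing hL hg x y) =
      pairing hL hg (thetaOp K • x) y + pairing hL hg x (thetaOp K • y) := by
  have : pairing hL hg (thetaOp K • x) = dualTheta n a (pairing hL hg x) :=
    latticeLift_thetaOp x
  rw [this, dualTheta_apply, sub_add_cancel]

/-- Pairings of total degree below n-1 vanish, so their derivatives do too, and moving one θ across
the pairing only changes the sign. -/
theorem pairing_eta (hL : IsCalabiYau n a) (hg : IsJordanSolution n a g) (i j : ℕ)
    (h : i + j ≤ n - 1) : pairing hL hg (eta n a i) (eta n a j) =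
      if i + j = n - 1 then (-1) ^ i * (betaFactor n a)⁻¹ else 0 := by
  have hn := hL.one_le_order
  induction i generalizing j with
  | zero =>
    have : pairing hL hg (eta n a 0) = (betaFactor n a)⁻¹ • etaCoord hg (n - 1) :=
      latticeLift_eta 0
    rw [this, LinearMap.smul_apply, etaCoord_eta hg _ (by omega), zero_add, pow_zero, one_mul,
      smul_eq_mul, mul_ite, mul_one, mul_zero]
    exact if_congr eq_comm rfl rfl
  | succ i ih =>
    have h1 := pairing_horizontal hL hg (eta n a i) (eta n a j)
    rw [ih j (by omega), if_neg (by omega), map_zero, thetaOp_smul_eta, thetaOp_smul_eta,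
      ih (j + 1) (by omega)] at h1
    rw [eq_neg_of_add_eq_zero_left h1.symm]
    by_cases h3 : i + (j + 1) = n - 1
    · rw [if_pos h3, if_pos (by omega)]; ring
    · rw [if_neg h3, if_neg (by omega), neg_zero]

theorem pairing_sum_eta (hL : IsCalabiYau n a) (hg : IsJordanSolution n a g) {k l : ℕ}
    (h : k + l = n - 1) (v w : ℕ → K⟦X⟧) :
    pairing hL hg (∑ r ∈ Finset.range (k + 1), v r • eta n a r)
      (∑ r ∈ Finset.range (l + 1), w r • eta n a r) =
      v k * w l * ((-1) ^ k * (betaFactor n a)⁻¹) := by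
  simp only [map_sum, LinearMap.sum_apply, map_smul, LinearMap.smul_apply, smul_eq_mul]
  have hk : k ∈ Finset.range (k + 1) := Finset.self_mem_range_succ k
  have hl : l ∈ Finset.range (l + 1) := Finset.self_mem_range_succ l
  rw [Finset.sum_eq_single_of_mem l hl, Finset.sum_eq_single_of_mem k hk,
    pairing_eta hL hg k l h.le, if_pos h]
  · ring
  · intro r hr hne
    rw [Finset.mem_range] at hr
    rw [pairing_eta hL hg r l (by omega), if_neg (by omega), mul_zero]
  · intro s hs hne
    rw [Finset.mem_range] at hs
    refine mul_eq_zero_of_right _ (Finset.sum_eq_zero fun r hr => ?_)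
    rw [Finset.mem_range] at hr
    rw [pairing_eta hL hg r s (by omega), if_neg (by omega), mul_zero]

theorem exists_flatBasis (hg : IsJordanSolution n a g) :
    ∃ e : ℕ → Lattice n a, (∀ k, ∀ j < n, flatCoord hg (e k) j = if j = k then 1 else 0) ∧
      (∀ k, thetaOp K • e k = e (k + 1)) ∧ (∀ k, n ≤ k → e k = 0) ∧
      ∀ x, x = ∑ j ∈ Finset.range n, flatCoord hg x j • e j := by
  have h := fun k => exists_flatCoord_eq hg le_rfl fun j => if j = k then (1 : K⟦X⟧) else 0
  choose e _ he using h
  have hc : ∀ k, ∀ j < n, theta K (flatCoord hg (e k) j) = 0 := by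
    intro k j hj
    rw [he k j hj]
    split_ifs
    · exact Derivation.map_one_eq_zero _
    · exact map_zero _
  refine ⟨e, he, ?_, ?_, ?_⟩
  · intro k
    rw [← sub_eq_zero]
    apply eq_zero_of_flatCoord hg
    intro j hj
    rw [map_sub, Pi.sub_apply, he _ j hj]
    cases j with
    | zero => rw [flatCoord_thetaOp_zero, hc k 0 hj]; simp
    | succ j => rw [flatCoord_thetaOp_succ hg _ hj, hc k _ hj, he k j (by omega)]; simp
  · intro k hk
    apply eq_zero_of_flatCoord hg
    intro j hj
    rw [he k j hj, if_neg (by omega)]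
  · intro x
    rw [← sub_eq_zero]
    apply eq_zero_of_flatCoord hg
    intro j hj
    rw [map_sub, Pi.sub_apply, map_sum, Finset.sum_apply,
      Finset.sum_eq_single_of_mem j (Finset.mem_range.2 hj)]
    · rw [map_smul, Pi.smul_apply, he j j hj, if_pos rfl, smul_eq_mul, mul_one, sub_self]
    · intro i _ hij
      rw [map_smul, Pi.smul_apply, he i j hj, if_neg hij.symm, smul_zero]

/-- In the flat basis θ e_k = e_{k+1}, so θ b(k,l) = b(k+1,l) + b(k,l+1). Since e_k = 0 for k ≥ n, b
vanishes for k + l ≥ n and is therefore constant for k + l = n-1; only that one term survives for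
the given x and y. -/
theorem exists_const_pairing (hL : IsCalabiYau n a) (hg : IsJordanSolution n a g) {k l : ℕ}
    (h : k + l = n - 1) : ∃ c : K, ∀ x ∈ flatSub hg k, ∀ y ∈ flatSub hg l,
      pairing hL hg x y = flatCoord hg x k * flatCoord hg y l * PowerSeries.C c := by
  have hn := hL.one_le_order
  obtain ⟨e, he, hθ, hzero, hsum⟩ := exists_flatBasis hg
  set b : ℕ → ℕ → K⟦X⟧ := fun k l => pairing hL hg (e k) (e l) with hb
  have hθb : ∀ k l, theta K (b k l) = b (k + 1) l + b k (l + 1) := by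
    intro k l
    simp only [hb]
    rw [pairing_horizontal, hθ, hθ]
  have hbk : ∀ k l, n ≤ k → b k l = 0 := by
    intro k l hk
    simp only [hb]
    rw [hzero k hk, map_zero]; rfl
  have hbl : ∀ k l, n ≤ l → b k l = 0 := by
    intro k l hl
    simp only [hb]
    rw [hzero l hl, map_zero]
  -- Descending induction on s = k + l. Vanishing at s + 1 makes b constant at s.
  have hvan : ∀ d s, s + d = 2 * n → n ≤ s → ∀ k l, k + l = s → b k l = 0 := by
    intro d
    induction d with
    | zero =>
      intro s hs _ k l hkl
      rcases Nat.lt_or_ge k n with hk | hk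
      · exact hbl k l (by omega)
      · exact hbk k l hk
    | succ d ih =>
      intro s hs hns
      have h0 : ∀ k l, k + l = s → theta K (b k l) = 0 := by
        intro k l hkl
        rw [hθb, ih (s + 1) (by omega) (by omega) _ _ (by omega),
          ih (s + 1) (by omega) (by omega) _ _ (by omega), add_zero]
      -- Along one antidiagonal, start from b(n,l) = 0: the constant term of θ b(k,l) is 0, so
      -- b(k+1,l) and b(k,l+1) have opposite constant terms.
      have hj : ∀ j k l, k + j = n → k + l = s → b k l = 0 := by
        intro j
        induction j with
        | zero => intro k l hk _; exact hbk k l (by omega)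
        | succ j ihj =>
          intro k l hk hkl
          obtain ⟨l, rfl⟩ := Nat.exists_eq_add_of_lt (show 0 < l by omega)
          have h1 := congrArg PowerSeries.constantCoeff (hθb k (0 + l))
          rw [constantCoeff_theta, ihj (k + 1) (0 + l) (by omega) (by omega), zero_add] at h1
          rw [theta_eq_zero (h0 k (0 + l + 1) hkl), ← h1, map_zero]
      intro k l hkl
      rcases Nat.lt_or_ge k n with hk | hk
      · exact hj (n - k) k l (by omega) hkl
      · exact hbk k l hk
  have hvan' : ∀ k l, n ≤ k + l → b k l = 0 := by
    intro k l hkl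
    rcases le_total (k + l) (2 * n) with h1 | h1
    · exact hvan (2 * n - (k + l)) (k + l) (by omega) hkl k l rfl
    · rcases Nat.lt_or_ge k n with hk | hk
      · exact hbl k l (by omega)
      · exact hbk k l hk
  refine ⟨PowerSeries.constantCoeff (b k l), fun x hx y hy => ?_⟩
  rw [← theta_eq_zero (f := b k l)
    (by rw [hθb, hvan' _ _ (by omega), hvan' _ _ (by omega), add_zero])]
  conv_lhs => rw [hsum x, hsum y]
  simp only [map_sum, LinearMap.sum_apply, map_smul, LinearMap.smul_apply, smul_eq_mul]
  rw [Finset.sum_eq_single_of_mem l (Finset.mem_range.2 (by omega)),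
    Finset.sum_eq_single_of_mem k (Finset.mem_range.2 (by omega))]
  · simp only [hb]; ring
  · intro i hi hne
    rw [Finset.mem_range] at hi
    rcases Nat.lt_or_ge i k with hik | hik
    · rw [hx i hik hi, zero_mul]
    · have h1 : pairing hL hg (e i) (e l) = 0 := hvan' i l (by omega)
      rw [h1, mul_zero]
  · intro j hj hne
    rw [Finset.mem_range] at hj
    rcases Nat.lt_or_ge j l with hjl | hjl
    · rw [hy j hjl hj, zero_mul]
    · refine mul_eq_zero_of_right _ (Finset.sum_eq_zero fun i hi => ?_)
      rw [Finset.mem_range] at hi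
      rcases Nat.lt_or_ge i k with hik | hik
      · rw [hx i hik hi, zero_mul]
      · have h1 : pairing hL hg (e i) (e j) = 0 := hvan' i j (by omega)
        rw [h1, mul_zero]

theorem exists_adapted (hg : IsJordanSolution n a g) {k : ℕ} (hk : k < n) :
    ∃ v : ℕ → K⟦X⟧, (jordanMatrix g (k + 1)).det * v k = (jordanMatrix g k).det ∧
      (∑ r ∈ Finset.range (k + 1), v r • eta n a r) ∈ flatSub hg k ∧
      flatCoord hg (∑ r ∈ Finset.range (k + 1), v r • eta n a r) k = 1 := by
  obtain ⟨x, hx, hxy⟩ := exists_flatCoord_eq hg (k := k + 1) hk fun j => if j = k then 1 else 0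
  obtain ⟨v, rfl⟩ := mem_etaSpan.1 hx
  refine ⟨v, ?_, fun j hj _ => ?_, ?_⟩
  · have := det_jordanMatrix_mul_of_mulVec (g := g) (k := k) (v := fun j => v j) (p := 1) (by
      ext1 r
      rw [← flatCoord_sum hg hk, hxy r r.2, Pi.single_apply]
      exact if_congr (by rw [Fin.ext_iff]; rfl) rfl rfl)
    rwa [mul_one] at this
  · rw [hxy j (by omega), if_neg hj.ne]
  · rw [hxy k (by omega), if_pos rfl]

/-- The symmetry of the wronskians of a self-adjoint operator. -/
theorem det_jordanMatrix_symm (hL : IsCalabiYau n a) (hg : IsJordanSolution n a g) {k l : ℕ}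
    (h : k + l = n - 1) :
    (jordanMatrix g k).det * (jordanMatrix g l).det =
      betaFactor n a * ((jordanMatrix g (k + 1)).det * (jordanMatrix g (l + 1)).det) := by
  have hn := hL.one_le_order
  obtain ⟨v, hv, hv1, hv2⟩ := exists_adapted hg (k := k) (by omega)
  obtain ⟨w, hw, hw1, hw2⟩ := exists_adapted hg (k := l) (by omega)
  obtain ⟨c, hc⟩ := exists_const_pairing hL hg h
  have h1 := hc _ hv1 _ hw1
  rw [pairing_sum_eta hL hg h, hv2, hw2, one_mul, one_mul] at h1
  have hβ : betaFactor n a * (betaFactor n a)⁻¹ = 1 :=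
    PowerSeries.mul_inv_cancel _ (by rw [constantCoeff_betaFactor]; exact one_ne_zero)
  have hdet := constantCoeff_det_jordanMatrix hg.constantCoeff
  have hv0 := congrArg PowerSeries.constantCoeff hv
  have hw0 := congrArg PowerSeries.constantCoeff hw
  rw [map_mul, hdet, hdet, one_mul] at hv0 hw0
  -- All determinants and β have constant term 1, so evaluation at t = 0 identifies c as (-1)^k.
  have hc0 := congrArg PowerSeries.constantCoeff h1
  have hβ0 := congrArg PowerSeries.constantCoeff hβ
  rw [map_mul, constantCoeff_betaFactor, one_mul, map_one] at hβ0
  simp only [map_mul, hv0, hw0, hβ0, one_mul, mul_one, map_pow, map_neg, map_one,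
    PowerSeries.constantCoeff_C] at hc0
  rw [← hc0, map_pow, map_neg, map_one] at h1
  have hsq : ((-1 : K⟦X⟧) ^ k) * (-1) ^ k = 1 := by rw [← mul_pow]; simp
  have h2 : v k * w l = betaFactor n a := by
    calc v k * w l = (v k * w l * ((-1) ^ k * (betaFactor n a)⁻¹)) * (-1) ^ k * betaFactor n a := by
          linear_combination (-(v k * w l)) * hsq * (betaFactor n a * (betaFactor n a)⁻¹) -
            (v k * w l) * hβ
      _ = betaFactor n a := by rw [h1, hsq, one_mul]
  rw [← hv, ← hw, ← h2]
  ring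

end Duality

/-! ### The adapted basis -/

section Adapted

variable {n : ℕ} {a : ℕ → RatFunc K} {g : ℕ → K⟦X⟧}

theorem sum_eta_mem_etaSpan (k : ℕ) (v : ℕ → K⟦X⟧) :
    ∑ r ∈ Finset.range k, v r • eta n a r ∈ etaSpan n a k :=
  mem_etaSpan.2 ⟨v, rfl⟩

theorem thetaOp_smul_sum_eta (k : ℕ) (v : ℕ → K⟦X⟧) :
    thetaOp K • (∑ r ∈ Finset.range (k + 1), v r • eta n a r) - v k • eta n a (k + 1) ∈
      etaSpan n a (k + 1) := by
  have h : thetaOp K • (∑ r ∈ Finset.range (k + 1), v r • eta n a r) - v k • eta n a (k + 1) =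
      ∑ r ∈ Finset.range k, v r • eta n a (r + 1) +
        ∑ r ∈ Finset.range (k + 1), theta K (v r) • eta n a r := by
    rw [Finset.smul_sum]
    simp only [thetaOp_smul_smul, thetaOp_smul_eta]
    rw [Finset.sum_add_distrib, Finset.sum_range_succ (fun r => v r • eta n a (r + 1))]
    abel
  rw [h]
  refine add_mem (sum_mem fun r hr => ?_) (sum_eta_mem_etaSpan _ _)
  rw [Finset.mem_range] at hr
  exact Submodule.smul_mem _ _ (eta_mem_etaSpan (by omega))

variable [CharZero K]

theorem eq_of_mem_flatSub (hg : IsJordanSolution n a g) {k : ℕ} {x y : Lattice n a}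
    (hx : x ∈ flatSub hg k) (hy : y ∈ flatSub hg k) (h : x - y ∈ etaSpan n a k) : x = y := by
  have hd := (isCompl_flatSub hg k).disjoint
  rw [Submodule.disjoint_def] at hd
  exact sub_eq_zero.1 (hd _ (sub_mem hx hy) h)

/-- A sequence in `Λ` normalized with respect to the flat coordinates. -/
structure IsNormalized (hg : IsJordanSolution n a g) (u : Fin n → Lattice n a) : Prop where
  mem : ∀ i : Fin n, u i ∈ flatSub hg (n - 1 - i)
  coord : ∀ i : Fin n, flatCoord hg (u i) (n - 1 - i) = 1

variable {hg : IsJordanSolution n a g} {u : Fin n → Lattice n a}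

theorem IsNormalized.mem_of_le (hu : IsNormalized hg u) {i j : Fin n} (h : j ≤ i) :
    u j ∈ flatSub hg (n - 1 - i) := by
  have : (j : ℕ) ≤ i := h
  exact flatSub_anti hg (by omega) (hu.mem j)

/-- Triangular elimination: subtracting the multiple of u_i given by coordinate n-1-i makes one more
coordinate vanish. -/
theorem IsNormalized.flatSub_eq_span (hu : IsNormalized hg u) (i : Fin n) :
    (flatSub hg (n - 1 - i)).restrictScalars K⟦X⟧ =
      Submodule.span K⟦X⟧ {x | ∃ r ≤ i, x = u r} := by
  apply le_antisymm
  · obtain ⟨i, hi⟩ := i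
    induction i with
    | zero =>
      intro x hx
      have h0 : x - flatCoord hg x (n - 1) • u ⟨0, hi⟩ = 0 := by
        apply eq_zero_of_flatCoord hg
        intro j hj
        rw [map_sub, map_smul, Pi.sub_apply, Pi.smul_apply]
        rcases Nat.lt_or_ge j (n - 1) with h | h
        · rw [hx j h hj, hu.mem ⟨0, hi⟩ j h hj, smul_zero, sub_zero]
        · have h2 := hu.coord ⟨0, hi⟩
          rw [show n - 1 - ((⟨0, hi⟩ : Fin n) : ℕ) = j by simp; omega] at h2
          rw [h2, show n - 1 = j by omega, smul_eq_mul, mul_one, sub_self]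
      rw [sub_eq_zero.1 h0]
      exact Submodule.smul_mem _ _ (Submodule.subset_span ⟨_, le_rfl, rfl⟩)
    | succ i ih =>
      intro x hx
      have hi' : i < n := by omega
      have h0 : x - flatCoord hg x (n - 1 - (i + 1)) • u ⟨i + 1, hi⟩ ∈
          (flatSub hg (n - 1 - i)).restrictScalars K⟦X⟧ := by
        intro j hj hjn
        rw [map_sub, map_smul, Pi.sub_apply, Pi.smul_apply]
        rcases Nat.lt_or_ge j (n - 1 - (i + 1)) with h | h
        · rw [hx j h hjn, hu.mem ⟨i + 1, hi⟩ j h hjn, smul_zero, sub_zero]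
        · have h1 : n - 1 - (i + 1) = j := by omega
          have h2 := hu.coord ⟨i + 1, hi⟩
          simp only [h1] at h2 ⊢
          rw [h2, smul_eq_mul, mul_one, sub_self]
      have h1 := ih hi' h0
      rw [← sub_add_cancel x (flatCoord hg x (n - 1 - (i + 1)) • u ⟨i + 1, hi⟩)]
      refine add_mem (Submodule.span_mono ?_ h1)
        (Submodule.smul_mem _ _ (Submodule.subset_span ⟨_, le_rfl, rfl⟩))
      rintro _ ⟨r, hr, rfl⟩
      exact ⟨r, hr.trans (Nat.le_succ i), rfl⟩
  · refine Submodule.span_le.2 ?_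
    rintro _ ⟨r, hr, rfl⟩
    exact hu.mem_of_le hr

theorem IsNormalized.linearIndependent (hu : IsNormalized hg u) : LinearIndependent K⟦X⟧ u := by
  rw [Fintype.linearIndependent_iff]
  intro c hc
  have key : ∀ k, ∀ i : Fin n, n - 1 - i = k → c i = 0 := by
    intro k
    induction k using Nat.strong_induction_on with
    | _ k ih =>
      intro i hi
      have h1 := congrArg (fun x => flatCoord hg x (n - 1 - i)) hc
      simp only [map_sum, map_smul, Finset.sum_apply, Pi.smul_apply, map_zero,
        Pi.zero_apply] at h1
      rw [Finset.sum_eq_single_of_mem i (Finset.mem_univ i), hu.coord i, smul_eq_mul,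
        mul_one] at h1
      · exact h1
      · intro j _ hji
        have hne : (j : ℕ) ≠ i := fun h => hji (Fin.ext h)
        rcases Nat.lt_or_ge j i with h | h
        · rw [hu.mem j _ (by omega) (by omega), smul_zero]
        · rw [ih (n - 1 - j) (by omega) j rfl, zero_smul]
  exact fun i => key _ i rfl

theorem IsNormalized.span_eq_top (hu : IsNormalized hg u) :
    Submodule.span K⟦X⟧ (Set.range u) = ⊤ := by
  rw [eq_top_iff]
  intro x _
  rcases Nat.eq_zero_or_pos n with rfl | hn
  · rw [eq_zero_of_flatCoord hg (x := x) fun j hj => absurd hj (Nat.not_lt_zero j)]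
    exact zero_mem _
  · have h : x ∈ (flatSub hg (n - 1 - ((⟨n - 1, by omega⟩ : Fin n) : ℕ))).restrictScalars K⟦X⟧ :=
      fun j hj _ => by simp at hj
    rw [hu.flatSub_eq_span] at h
    refine Submodule.span_mono ?_ h
    rintro _ ⟨r, _, rfl⟩
    exact ⟨r, rfl⟩

/-- The first nonvanishing coordinate of u_i is the constant 1, which θ kills, and the coordinate
before it contributes 0. -/
theorem IsNormalized.thetaOp_mem (hu : IsNormalized hg u) (i : Fin n) :
    thetaOp K • u i ∈ flatSub hg (n - 1 - i + 1) := by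
  intro j hj hjn
  rcases Nat.lt_or_ge j (n - 1 - i) with h | h
  · exact Submodule.smul_mem (flatSub hg (n - 1 - i)) (thetaOp K) (hu.mem i) j h hjn
  · have hj' : n - 1 - (i : ℕ) = j := by omega
    have h1 := hu.coord i
    rw [hj'] at h1
    cases j with
    | zero => rw [flatCoord_thetaOp_zero, h1, Derivation.map_one_eq_zero]
    | succ j =>
      rw [flatCoord_thetaOp_succ hg _ hjn, h1, Derivation.map_one_eq_zero, zero_add]
      exact hu.mem i j (by omega) (by omega)

end Adapted

/-! ### The canonical coordinate -/

section QCoordinate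

variable {n : ℕ} {a : ℕ → RatFunc K} {g : ℕ → K⟦X⟧}

theorem logSeries_zero (g : ℕ → K⟦X⟧) : logSeries 0 g = Polynomial.C (g 0) := by
  simp [logSeries_apply]

theorem logSeries_one (g : ℕ → K⟦X⟧) :
    logSeries 1 g = Polynomial.C (g 1) + Polynomial.C (g 0) * Polynomial.X := by
  simp [logSeries_apply, Finset.sum_range_succ, ← Polynomial.C_mul_X_eq_monomial]

variable [CharZero K]

theorem IsJordanSolution.exists_qCoordinate (hg : IsJordanSolution n a g)
    (h1 : PowerSeries.constantCoeff (g 1) = 0) :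
    ∃ q, IsQCoordinate (fun i => logSeries i g) q := by
  have h : g 0 * (g 0)⁻¹ = 1 :=
    PowerSeries.mul_inv_cancel _ (by rw [hg.constantCoeff]; exact one_ne_zero)
  refine ⟨_, g 1 * (g 0)⁻¹, by rw [map_mul, h1, zero_mul], ?_, rfl⟩
  simp only [logSeries_zero, logSeries_one]
  rw [mul_add, ← map_mul, mul_left_comm, h, mul_one, add_comm]

/-- With F_1 / F_0 = log t + f one has g_1 = g_0 f, so the 2 × 2 wronskian is g_0² (1 + θ f), and
both τ_1 and θ(q)/q equal 1 + θ f. -/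
theorem theta_qCoordinate {F : ℕ → K⟦X⟧[X]} (hn : 2 ≤ n) (hg : IsJordanSolution n a g)
    (hF : ∀ i < n, F i = logSeries i g) {q : K⟦X⟧} (hq : IsQCoordinate F q) :
    PowerSeries.coeff 0 q = 0 ∧ PowerSeries.coeff 1 q = 1 ∧ theta K q = tau F 1 * q := by
  obtain ⟨f, hf, hF1, rfl⟩ := hq
  have hexp := constantCoeff_expSeries hf
  refine ⟨by simp, ?_, ?_⟩
  · rw [show (1 : ℕ) = 0 + 1 from rfl, PowerSeries.coeff_succ_X_mul]
    simpa using hexp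
  · rw [hF 1 (by omega), hF 0 (by omega), logSeries_zero, logSeries_one] at hF1
    have hg1 : g 1 = g 0 * f := by
      have := congrArg (fun p => Polynomial.coeff p 0) hF1
      simpa using this
    have hunit : (g 0) ^ 2 * ((g 0) ^ 2)⁻¹ = 1 :=
      PowerSeries.mul_inv_cancel _ (by rw [map_pow, hg.constantCoeff]; simp)
    have h2 : (jordanMatrix g 2).det = g 0 ^ 2 * (1 + theta K f) := by
      have e00 : jordanMatrix g 2 0 0 = g 0 := rfl
      have e01 : jordanMatrix g 2 0 1 = theta K (g 0) := by
        change (jordan K ^ (0 + 1)) g 0 = _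
        rw [end_pow_succ_apply, jordan_zero]; rfl
      have e10 : jordanMatrix g 2 1 0 = g 1 := rfl
      have e11 : jordanMatrix g 2 1 1 = theta K (g 1) + g 0 := by
        change (jordan K ^ (0 + 1)) g (0 + 1) = _
        rw [end_pow_succ_apply, jordan_succ]; rfl
      rw [Matrix.det_fin_two, e00, e01, e10, e11, hg1, Derivation.leibniz, smul_eq_mul,
        smul_eq_mul]
      ring
    have hd1 : (jordanMatrix g 1).det = g 0 := by rw [Matrix.det_fin_one]; rfl
    have htau : tau F 1 = 1 + theta K f := by
      rw [tau, wr_eq hF (by omega), wr_eq hF (by omega), wr_eq hF (by omega), hd1, h2,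
        Matrix.det_fin_zero]
      linear_combination (1 + theta K f) * hunit
    have hX : theta K (PowerSeries.X : K⟦X⟧) = PowerSeries.X := by
      rw [theta_apply, PowerSeries.derivative_X, mul_one]
    rw [htau, Derivation.leibniz, hX, theta_expSeries hf, smul_eq_mul, smul_eq_mul]
    ring

end QCoordinate

/-! ### The adapted sequence: existence, uniqueness and derivatives. -/

theorem exists_isAdapted [CharZero K] {n : ℕ} {a : ℕ → RatFunc K} {g : ℕ → K⟦X⟧}
    (hL : IsCalabiYau n a) (hg : IsJordanSolution n a g)
    {U : ℤ → Submodule (DiffOp K) (Lattice n a)} (hU : IsOppositeFiltration n a U)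
    {F : ℕ → K⟦X⟧[X]} (hF : ∀ i < n, F i = logSeries i g) :
    ∃ u : Fin n → Lattice n a, IsAdapted n a U F (fun _ => 1) u ∧ IsNormalized hg u := by
  have hUi : ∀ i : Fin n, U (i : ℕ) = flatSub hg (n - 1 - i) := by
    intro i
    rw [hU.eq_flatSub hg]
    congr 1
    omega
  have h := fun i : Fin n => exists_adapted hg (k := n - 1 - i) (by omega)
  choose v hv hv1 hv2 using h
  have hnorm : IsNormalized hg fun i =>
      ∑ r ∈ Finset.range (n - 1 - i + 1), v i r • eta n a r := ⟨hv1, hv2⟩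
  refine ⟨_, ⟨fun i => ?_, fun i => ⟨v i, ?_, ?_⟩⟩, hnorm⟩
  · rw [hUi, hnorm.flatSub_eq_span]
  · rw [show n - (i : ℕ) = n - 1 - i + 1 by omega]
  · have hdet := constantCoeff_det_jordanMatrix hg.constantCoeff
    have hne := fun k => (isUnit_det_jordanMatrix hg.constantCoeff k).ne_zero
    -- Cramer's rule gives the quotient of wronskians at the complementary index n-1-i; the symmetry
    -- turns it into the required one at i, with the factor β.
    have hs := det_jordanMatrix_symm hL hg (k := n - 1 - i) (l := i) (by omega)
    have hinv : (jordanMatrix g i).det * (jordanMatrix g i).det⁻¹ = 1 :=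
      PowerSeries.mul_inv_cancel _ (by rw [hdet]; exact one_ne_zero)
    rw [wr_eq hF (by omega), wr_eq hF (by omega), map_one, one_mul]
    refine mul_left_cancel₀ (hne (n - 1 - i + 1)) ?_
    rw [hv]
    linear_combination (-(jordanMatrix g (n - 1 - i)).det) * hinv +
      (jordanMatrix g i).det⁻¹ * hs

/-- Both sides lie in U_i and their leading terms cancel, so the difference lies in U_i ∩ Fil^(i+1)
= 0. -/
theorem IsAdapted.eq_smul [CharZero K] {n : ℕ} {a : ℕ → RatFunc K} {g : ℕ → K⟦X⟧}
    (hg : IsJordanSolution n a g) {U : ℤ → Submodule (DiffOp K) (Lattice n a)}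
    (hU : IsOppositeFiltration n a U) {F : ℕ → K⟦X⟧[X]} {c : Fin n → K}
    {u w : Fin n → Lattice n a} (hu : IsAdapted n a U F (fun _ => 1) u)
    (hw : IsAdapted n a U F c w) (i : Fin n) : w i = (PowerSeries.C (c i) : K⟦X⟧) • u i := by
  have hmem : ∀ {c : Fin n → K} {w : Fin n → Lattice n a}, IsAdapted n a U F c w →
      w i ∈ (U (i : ℕ)).restrictScalars K⟦X⟧ := by
    intro c w hw
    rw [hw.generates i]
    exact Submodule.subset_span ⟨i, le_rfl, rfl⟩
  obtain ⟨v, hv, hv'⟩ := hu.leading i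
  obtain ⟨v', hw1, hw'⟩ := hw.leading i
  have hUi : U (i : ℕ) = flatSub hg (n - 1 - i) := by
    rw [hU.eq_flatSub hg]
    congr 1
    omega
  have h1 := hmem hw
  have h2 := Submodule.smul_mem _ (PowerSeries.C (c i) : K⟦X⟧) (hmem hu)
  rw [hUi] at h1 h2
  refine eq_of_mem_flatSub hg h1 h2 ?_
  rw [hv, hw1, show n - (i : ℕ) = n - 1 - i + 1 by omega, Finset.sum_range_succ,
    Finset.sum_range_succ, hv', hw', smul_add, smul_smul, map_one, one_mul, add_sub_add_right_eq_sub]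
  exact sub_mem (sum_eta_mem_etaSpan _ _) (Submodule.smul_mem _ _ (sum_eta_mem_etaSpan _ _))

/-- θ u_{i+1} lies in U_i and keeps the leading coefficient of u_{i+1}, now on η^(n-1-i); τ_{i+1} is
the ratio of the leading coefficients of u_{i+1} and u_i. -/
theorem IsAdapted.thetaOp_smul [CharZero K] {n : ℕ} {a : ℕ → RatFunc K} {g : ℕ → K⟦X⟧}
    {hg : IsJordanSolution n a g} {U : ℤ → Submodule (DiffOp K) (Lattice n a)}
    {F : ℕ → K⟦X⟧[X]} (hF : ∀ k ≤ n, IsUnit (wr F k))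
    {u : Fin n → Lattice n a} (hu : IsAdapted n a U F (fun _ => 1) u) (hn : IsNormalized hg u)
    {i : ℕ} (hi : i + 1 < n) :
    thetaOp K • u ⟨i + 1, hi⟩ = tau F (i + 1) • u ⟨i, Nat.lt_of_succ_lt hi⟩ := by
  have hwr : ∀ k ≤ n, wr F k * (wr F k)⁻¹ = 1 := fun k hk => PowerSeries.mul_inv_cancel _
    (PowerSeries.isUnit_iff_constantCoeff.1 (hF k hk)).ne_zero
  have hk : n - 1 - (i + 1) + 1 = n - 1 - i := by omega
  have h1 := hn.thetaOp_mem ⟨i + 1, hi⟩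
  have h2 := hn.mem ⟨i, Nat.lt_of_succ_lt hi⟩
  simp only [hk] at h1 h2
  refine eq_of_mem_flatSub hg h1 (by
    rw [powerSeries_smul_lattice]; exact Submodule.smul_mem _ _ h2) ?_
  obtain ⟨v, hv, hv'⟩ := hu.leading ⟨i + 1, hi⟩
  obtain ⟨w, hw, hw'⟩ := hu.leading ⟨i, Nat.lt_of_succ_lt hi⟩
  simp only [map_one, one_mul] at hv hv' hw hw'
  have h3 := thetaOp_smul_sum_eta (n := n) (a := a) (n - 1 - (i + 1)) v
  rw [hk] at h3
  have htau : tau F (i + 1) * w (n - 1 - i) = v (n - 1 - (i + 1)) := by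
    have hsq : (wr F (i + 1)) ^ 2 * ((wr F (i + 1)) ^ 2)⁻¹ = 1 := PowerSeries.mul_inv_cancel _
      (PowerSeries.isUnit_iff_constantCoeff.1 ((hF (i + 1) (by omega)).pow 2)).ne_zero
    rw [hv', hw', tau, Nat.add_sub_cancel]
    have e1 := hwr i (by omega)
    have e2 := hwr (i + 1) (by omega)
    refine mul_left_cancel₀ ((hF (i + 1) (by omega)).pow 2).ne_zero ?_
    linear_combination (betaFactor n a * wr F (i + 1 + 1) * wr F (i + 1)) *
      (wr F i * (wr F i)⁻¹ * hsq + e1 - e2)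
  rw [hv, hw, show n - (i + 1) = n - 1 - i by omega, show n - i = n - 1 - i + 1 by omega,
    Finset.sum_range_succ _ (n - 1 - i), smul_add, smul_smul, htau, ← sub_sub, sub_right_comm]
  exact sub_mem h3 (Submodule.smul_mem _ _ (sum_eta_mem_etaSpan _ _))

end CalabiYauODE

end

open CalabiYauODE in
theorem mainTheorem5 {K : Type*} [Field K] [CharZero K] (n : ℕ) (a : ℕ → RatFunc K)
    (hL : IsCalabiYau n a) :
    (∃! U : ℤ → Submodule (DiffOp K) (Lattice n a), IsOppositeFiltration n a U) ∧
    (∃ F : ℕ → K⟦X⟧[X], IsFrobeniusBasis n a F ∧ (2 ≤ n → ∃ q : K⟦X⟧, IsQCoordinate F q)) ∧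
    ∀ U : ℤ → Submodule (DiffOp K) (Lattice n a), IsOppositeFiltration n a U →
    ∀ F : ℕ → K⟦X⟧[X], IsFrobeniusBasis n a F →
      (∀ k ≤ n, wronskian F k = Polynomial.C (wr F k) ∧ IsUnit (wr F k)) ∧
      ∃ u : Fin n → Lattice n a,
        IsAdapted n a U F (fun _ => 1) u ∧
        (∀ (c : Fin n → K) (w : Fin n → Lattice n a), IsAdapted n a U F c w →
          ∀ i, w i = (PowerSeries.C (c i) : K⟦X⟧) • u i) ∧
        LinearIndependent K⟦X⟧ u ∧ Submodule.span K⟦X⟧ (Set.range u) = ⊤ ∧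
        (∀ (i : ℕ) (hi : i + 1 < n),
          thetaOp K • u ⟨i + 1, hi⟩ = tau F (i + 1) • u ⟨i, Nat.lt_of_succ_lt hi⟩) ∧
        (2 ≤ n → ∀ q : K⟦X⟧, IsQCoordinate F q →
          PowerSeries.coeff 0 q = 0 ∧ PowerSeries.coeff 1 q = 1 ∧
          theta K q = tau F 1 * q) := by
  have hnull := hL.nullExponents
  obtain ⟨g, hg, hg1⟩ := exists_jordanSolution hnull
  refine ⟨⟨_, isOppositeFiltration_flatSub hg, fun U hU => funext fun i => hU.eq_flatSub hg i⟩,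
    ⟨_, hg.isFrobeniusBasis, fun _ => hg.exists_qCoordinate hg1⟩, fun U hU F hF => ?_⟩
  -- From here on the flat coordinates come from the given F, not from the solution constructed for
  -- existence.
  obtain ⟨g, hg, hFg⟩ := hF.exists_jordanSolution hL.one_le_order
  have hwr : ∀ k ≤ n, wronskian F k = Polynomial.C (wr F k) ∧ IsUnit (wr F k) := by
    intro k hk
    rw [wr_eq hFg hk]
    exact ⟨wronskian_eq hFg hk, isUnit_det_jordanMatrix hg.constantCoeff k⟩
  obtain ⟨u, hu, hnorm⟩ := exists_isAdapted hL hg hU hFg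
  exact ⟨hwr, u, hu, fun c w hw => hu.eq_smul hg hU hw, hnorm.linearIndependent,
    hnorm.span_eq_top, fun i hi => hu.thetaOp_smul (fun k hk => (hwr k hk).2) hnorm hi,
    fun hn q hq => theta_qCoordinate hn hg hFg hq⟩
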